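/- **Model.** A time-varying graph (TVG) $\mathcal G$ has a finite set $V$ of nodes with unique identifiers, lifetime $[0,\infty)$, a constant crossing delay $\zeta>0$, and for each pair of distinct nodes a set of dates of presence of the undirected edge between them, which is a union of disjoint closed intervals of length at least $\zeta$. The footprint has as edges all pairs that are present at some date. Let $\mathcal R$ be the class of TVGs with connected footprint in which each footprint edge that is absent at a date is present again at some later date. Let $\mathcal B\subset\mathcal R$ be the class of those for which there is a $\Delta>0$ such that every footprint edge appears for the first time at a date at most $\Delta$ and, whenever it appears and does not stay present forever, appears again after at most $\Delta$. Let $\mathcal P\subset\mathcal B$ be the class of TVGs with connected footprint for which there is a $p>0$ such that an edge is present at date $t\ge 0$ if and only if it is present at date $t+kp$, for all $k\in\mathbb N$. The contexts $\mathcal R_n$, $\mathcal B_\Delta$, $\mathcal P_p$ denote these classes where all nodes are given, respectively, $n=|V|$, some valid bound $\Delta$, some valid $p$ (the period or a multiple of it). An execution of a (deterministic) algorithm starts at some date $t\ge0$ at all nodes. At each date, a node decides which message to send to each neighbour, and its output, from its identifier, its input, the context's knowledge, $\zeta$, the start date and the current date, the presence of its incident edges since the start, and the messages received so far. Each message is either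 an information message or a control message; a message sent at date $s$ is delivered at $s+\zeta$ if the edge is present during all of $[s,s+\zeta]$, and is lost otherwise. Only finitely many messages may be sent in bounded time. A problem consists of types of inputs and outputs, admissible inputs for each TVG, and, for each TVG, input assignment and date $t'$, an arbitrary set of correct behaviours (a behaviour says which information messages are sent and which outputs the nodes have at which dates). For a context $\mathcal C_K$, let $\mathscr P(\mathcal C_K)$ be the set of problems solvable in $\mathcal C_K$: some algorithm is such that for every $\mathcal G\in\mathcal C$ with every correct value of the knowledge $K$, all admissible inputs and every start date $t\ge 0$ there is a finite date $t'\ge t$ before which the algorithm sends no information message and has no output (it may prepare by means of control messages), and its behaviour is correct for the problem posed at date $t'$. Let $\mathscr P_0(\mathcal C_K)\subseteq\mathscr P(\mathcal C_K)$ be the set of problems that are solvable in this way with $t'=t$ always. A journey is a finite sequence of hops $(e_i,t_i)$ along a walk with $t_{i+1}\ge t_i+\zeta$ and $e_i$ present during $[t_i,t_i+\zeta]$; it departs at its first $t_i$ and arrives at its last $t_i+\zeta$. In TDB (broadcast with termination detection), posed at date $t'$, one node, the emitter, holds the information from date $t'$ on; the information spreads along the journeys departing at $t'$ or later whose hops are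 information messages; the emitter must eventually enter a terminal state, which it never leaves, and may be in it only when all nodes have received the information. In TDB[shortest], moreover, each node first receives the information along a journey whose number of hops is minimum among all journeys of $\mathcal G$ from the emitter to it that depart at $t'$ or later. In TDB[fastest], moreover, the duration from the first emission of information by the emitter to the date by which all nodes have received it must be minimum among all broadcasts from the emitter that the schedule of $\mathcal G$ allows and that start at $t'$ or later, provided that this minimum exists. **Theorem.** $$\mathscr P(\mathcal R_n)\subsetneq\mathscr P(\mathcal B_\Delta)\subsetneq\mathscr P(\mathcal P_p).$$ The left inclusion is separated by TDB[shortest], which belongs to $\mathscr P_0(\mathcal B_\Delta)\subseteq\mathscr P(\mathcal B_\Delta)$ but not to $\mathscr P(\mathcal R_n)$; the right inclusion is separated by TDB[fastest], which belongs to $\mathscr P_0(\mathcal P_p)\subseteq\mathscr P(\mathcal P_p)$ but not to $\mathscr P(\mathcal B_\Delta)$. -/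

import Mathlib

namespace DynNet

/-! ### Time-varying graphs -/

/-- A time-varying graph with finitely many nodes, lifetime `[0, ∞)` and constant crossing delay
`ζ > 0`. A node is its (unique) identifier, a natural number; `pres u v` is the set of dates at
which the undirected edge `uv` is present. -/
structure TVG where
  nodes : Finset ℕ
  ζ : ℝ
  ζ_pos : 0 < ζ
  pres : ℕ → ℕ → Set ℝ
  pres_symm : ∀ u v, pres u v = pres v u
  pres_self : ∀ u, pres u u = ∅
  pres_nodes : ∀ u v, (pres u v).Nonempty → u ∈ nodes ∧ v ∈ nodes
  pres_nonneg : ∀ u v, ∀ t ∈ pres u v, 0 ≤ t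
  /- The dates of presence of an edge form a union of disjoint closed intervals of length at
  least `ζ`: they form a closed set each point of which lies in an interval of length `ζ` inside
  the set. -/
  pres_closed : ∀ u v, IsClosed (pres u v)
  pres_length : ∀ u v, ∀ t ∈ pres u v,
    ∃ a, t ∈ Set.Icc a (a + ζ) ∧ Set.Icc a (a + ζ) ⊆ pres u v

namespace TVG

variable (G : TVG)

/-- `uv` is an edge: `u` and `v` have at least one contact. -/
def IsEdge (u v : ℕ) : Prop := (G.pres u v).Nonempty

/-- The footprint (underlying static graph). -/
def footprint : SimpleGraph {v : ℕ // v ∈ G.nodes} where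
  Adj u v := G.IsEdge u v
  symm := ⟨fun u v h => by
    unfold IsEdge at *
    rw [G.pres_symm]
    exact h⟩
  loopless := ⟨fun u h => by simp [IsEdge, G.pres_self] at h⟩

/-- The edge `uv` appears at date `s`: it is present at `s` and absent just before `s`. -/
def AppearsAt (u v : ℕ) (s : ℝ) : Prop :=
  s ∈ G.pres u v ∧ ∃ ε > 0, ∀ r ∈ Set.Ioo (s - ε) s, r ∉ G.pres u v

/-- The class `R`: connected footprint, and no edge disappears forever. -/
def Recurrent : Prop :=
  G.footprint.Connected ∧
    ∀ u v, G.IsEdge u v → ∀ t, 0 ≤ t → t ∉ G.pres u v → ∃ t' > t, t' ∈ G.pres u v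

/-- The graph is in the class `B` and `Δ` is a bound on its recurrence time: every edge appears
for the first time within `Δ`, and whenever it appears and does not stay present forever, it
appears again after at most `Δ`. -/
def BoundedRecurrent (Δ : ℝ) : Prop :=
  G.Recurrent ∧ 0 < Δ ∧
    ∀ u v, G.IsEdge u v →
      (∃ s ≤ Δ, G.AppearsAt u v s) ∧
      ∀ s, G.AppearsAt u v s → (∃ r > s, r ∉ G.pres u v) →
        ∃ s', s < s' ∧ s' ≤ s + Δ ∧ G.AppearsAt u v s'

/-- The graph is in the class `P` and its topological events repeat identically modulo `p`. -/
def Periodic (p : ℝ) : Prop :=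
  G.footprint.Connected ∧ 0 < p ∧
    ∀ u v, G.IsEdge u v → ∀ t, 0 ≤ t → ∀ k : ℕ, (t ∈ G.pres u v ↔ t + k * p ∈ G.pres u v)

end TVG

/-! ### Journeys -/

/-- Crossing the edge from `src` to `dst`, starting at `date`. -/
structure Hop where
  src : ℕ
  dst : ℕ
  date : ℝ

/-- `J` leads from `u` to `v` by consecutive hops that all satisfy `ok`; the first one starts at
date `t` or later, and each next one starts at least `ζ` after the previous one. -/
def IsJourney (ζ : ℝ) (ok : Hop → Prop) : ℝ → ℕ → List Hop → ℕ → Prop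
  | _, u, [], v => u = v
  | t, u, h :: J, v => h.src = u ∧ t ≤ h.date ∧ ok h ∧ IsJourney ζ ok (h.date + ζ) h.dst J v

/-- The arrival date of a journey (the date `t` itself for the empty journey). -/
def arrival (ζ t : ℝ) (J : List Hop) : ℝ :=
  match J.getLast? with
  | none => t
  | some h => h.date + ζ

namespace TVG

/-- The edge is present during the whole crossing. -/
def Crossable (G : TVG) (h : Hop) : Prop :=
  Set.Icc h.date (h.date + G.ζ) ⊆ G.pres h.src h.dst

/-- `J` is a journey of `G` from `u` to `v` with departure at date `t` or later. -/
def Journey (G : TVG) (t : ℝ) (u : ℕ) (J : List Hop) (v : ℕ) : Prop :=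
  IsJourney G.ζ G.Crossable t u J v

end TVG

/-! ### Distributed algorithms and their executions -/

/-- What a node knows at date `now`. -/
structure View (K Input Msg : Type) where
  id : ℕ
  input : Input
  /-- the additional knowledge, the same at all nodes -/
  knowledge : K
  /-- the crossing delay -/
  ζ : ℝ
  /-- the date at which the execution started -/
  start : ℝ
  now : ℝ
  /-- for each neighbour, the dates (so far) at which the edge to it was present -/
  seen : ℕ → Set ℝ
  /-- the message received (so far) from a given neighbour at a given date, if any; the Boolean
  says whether it is an information message (`true`) or a control message (`false`) -/
  inbox : ℕ → ℝ → Option (Bool × Msg)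

/-- A deterministic distributed algorithm: at every date each node decides, from its view, which
message to send to which neighbour, and what its output is (`none`: no output). -/
structure Algorithm (K Input Output : Type) where
  Msg : Type
  send : View K Input Msg → ℕ → Option (Bool × Msg)
  output : View K Input Msg → Option Output

section Execution

variable {K Input Output : Type}

open Classical in
/-- The view of node `v` at date `t`, if `sent u w s` is the message sent by `u` to `w` at date
`s`. A message is delivered after the crossing delay if the edge is present all along, and is lost
otherwise. -/
noncomputable def viewAt {Msg : Type} (G : TVG) (k : K) (inp : ℕ → Input) (t₀ : ℝ)
    (sent : ℕ → ℕ → ℝ → Option (Bool × Msg)) (v : ℕ) (t : ℝ) : View K Input Msg where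
  id := v
  input := inp v
  knowledge := k
  ζ := G.ζ
  start := t₀
  now := t
  seen w := G.pres v w ∩ Set.Icc t₀ t
  inbox w s :=
    if s ≤ t ∧ Set.Icc (s - G.ζ) s ⊆ G.pres w v then sent w v (s - G.ζ) else none

open Classical in
/-- `sent` records the messages sent in the execution of `A` in `G` which starts at date `t₀`, with
inputs `inp` and knowledge `k`. -/
def IsRun (A : Algorithm K Input Output) (G : TVG) (k : K) (inp : ℕ → Input) (t₀ : ℝ)
    (sent : ℕ → ℕ → ℝ → Option (Bool × A.Msg)) : Prop :=
  ∀ v w t, sent v w t =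
    if t₀ ≤ t ∧ t ∈ G.pres v w then A.send (viewAt G k inp t₀ sent v t) w else none

/-- The view at date `t` depends only on what was sent up to date `t - ζ`. -/
theorem viewAt_congr {Msg : Type} (G : TVG) (k : K) (inp : ℕ → Input) (t₀ : ℝ)
    {sent sent' : ℕ → ℕ → ℝ → Option (Bool × Msg)} (v : ℕ) (t : ℝ)
    (h : ∀ w s, s ≤ t - G.ζ → sent w v s = sent' w v s) :
    viewAt G k inp t₀ sent v t = viewAt G k inp t₀ sent' v t := by
  have : (viewAt G k inp t₀ sent v t).inbox = (viewAt G k inp t₀ sent' v t).inbox := by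
    funext w s
    simp only [viewAt]
    split_ifs with hs
    · exact h w _ (by linarith [hs.1])
    · rfl
  simp only [viewAt] at this ⊢
  rw [this]

/-- Every execution exists and is unique. -/
theorem existsUnique_isRun (A : Algorithm K Input Output) (G : TVG) (k : K) (inp : ℕ → Input)
    (t₀ : ℝ) : ∃! sent, IsRun A G k inp t₀ sent := by
  classical
  let step : (ℕ → ℕ → ℝ → Option (Bool × A.Msg)) → (ℕ → ℕ → ℝ → Option (Bool × A.Msg)) :=
    fun S v w t =>
      if t₀ ≤ t ∧ t ∈ G.pres v w then A.send (viewAt G k inp t₀ S v t) w else none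
  have hstep : ∀ (S S' : ℕ → ℕ → ℝ → Option (Bool × A.Msg)) (b : ℝ),
      (∀ v w t, t < b → S v w t = S' v w t) →
      ∀ v w t, t < b + G.ζ → step S v w t = step S' v w t := by
    intro S S' b h v w t ht
    simp only [step]
    rw [viewAt_congr G k inp t₀ v t (fun w' s hs => h w' v s (by linarith))]
  have key : ∀ (S S' : ℕ → ℕ → ℝ → Option (Bool × A.Msg)) (N : ℕ) v w t,
      t < t₀ + N * G.ζ → step^[N + 1] S v w t = step^[N + 1] S' v w t := by
    intro S S' N
    induction N with
    | zero =>
      intro v w t ht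
      have h0 : ¬ t₀ ≤ t := by
        simp at ht
        linarith
      simp [step, h0]
    | succ N ih =>
      intro v w t ht
      rw [Function.iterate_succ_apply' step (N + 1) S, Function.iterate_succ_apply' step (N + 1) S']
      refine hstep _ _ _ ih v w t ?_
      push_cast at ht
      linarith
  have arch : ∀ t : ℝ, ∃ N : ℕ, t < t₀ + N * G.ζ := by
    intro t
    obtain ⟨N, hN⟩ := exists_nat_gt ((t - t₀) / G.ζ)
    rw [div_lt_iff₀ G.ζ_pos] at hN
    exact ⟨N, by linarith⟩
  choose N hN using arch
  let E : ℕ → ℕ → ℝ → Option (Bool × A.Msg) := fun _ _ _ => none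
  let R : ℕ → ℕ → ℝ → Option (Bool × A.Msg) := fun v w t => step^[N t + 1] E v w t
  have hR : ∀ (M : ℕ) v w t, t < t₀ + M * G.ζ → R v w t = step^[M + 1] E v w t := by
    intro M v w t ht
    rcases le_total (N t) M with h | h
    · obtain ⟨j, rfl⟩ := Nat.exists_eq_add_of_le h
      rw [show N t + j + 1 = (N t + 1) + j by ring, Function.iterate_add_apply]
      exact key _ _ (N t) v w t (hN t)
    · obtain ⟨j, hj⟩ := Nat.exists_eq_add_of_le h
      change step^[N t + 1] E v w t = _
      rw [hj, show M + j + 1 = (M + 1) + j by ring, Function.iterate_add_apply]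
      exact key _ _ M v w t ht
  refine ⟨R, ?_, ?_⟩
  · intro v w t
    change R v w t = step R v w t
    have h1 : t < t₀ + (N t + 1 : ℕ) * G.ζ := by
      have h2 := hN t
      have h3 := G.ζ_pos
      push_cast
      linarith
    rw [hR (N t + 1) v w t h1, Function.iterate_succ_apply']
    refine hstep _ _ (t₀ + N t * G.ζ) (fun v w s hs => (hR (N t) v w s hs).symm) v w t ?_
    push_cast at h1
    linarith
  · intro S hS
    have hfix : step S = S := by
      funext v w t
      exact (hS v w t).symm
    funext v w t
    have h1 : ∀ n, step^[n] S = S := fun n => Function.iterate_fixed hfix n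
    have h2 := key S E (N t) v w t (hN t)
    rw [h1] at h2
    exact h2

/-- What can be observed from outside during an execution. -/
structure Behaviour (Output : Type) where
  /-- `info u v s`: node `u` sends an information message to `v` at date `s` -/
  info : ℕ → ℕ → ℝ → Prop
  /-- `out v s`: the output of node `v` at date `s`, if any -/
  out : ℕ → ℝ → Option Output

open Classical in
/-- The observable behaviour of an execution. -/
noncomputable def behaviour (A : Algorithm K Input Output) (G : TVG) (k : K) (inp : ℕ → Input)
    (t₀ : ℝ) (sent : ℕ → ℕ → ℝ → Option (Bool × A.Msg)) : Behaviour Output where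
  info u v s := ∃ m, sent u v s = some (true, m)
  out v s :=
    if t₀ ≤ s ∧ v ∈ G.nodes then A.output (viewAt G k inp t₀ sent v s) else none

/-- Before date `t`, no information message is sent and no node has an output. -/
def Behaviour.SilentBefore (β : Behaviour Output) (t : ℝ) : Prop :=
  ∀ s < t, ∀ v, β.out v s = none ∧ ∀ w, ¬ β.info v w s

end Execution

/-! ### Problems and solvability -/

/-- A (distributed) problem: the types of the inputs and outputs, the input assignments considered
in each graph, and the behaviours that are correct in each graph for each assignment of inputs and
each date from which the problem is to be solved. -/
structure Problem where
  Input : Type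
  Output : Type
  Admissible : TVG → (ℕ → Input) → Prop
  Correct : TVG → (ℕ → Input) → ℝ → Behaviour Output → Prop

/-- A class of graphs with some knowledge: `Holds G k` says that `G` is in the class and that `k` is
a correct value of the knowledge for `G`. -/
structure Context where
  K : Type
  Holds : TVG → K → Prop

/-- In each execution of `A` in `G` with knowledge `k`, whatever the inputs and the start date `t`,
only finitely many messages are sent in bounded time and, for some `t'` with `delay t t'`, nothing
is visible before date `t'` and the behaviour is correct for the problem posed at date `t'`. -/
def SolvesIn {K : Type} (delay : ℝ → ℝ → Prop) (Q : Problem) (A : Algorithm K Q.Input Q.Output)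
    (G : TVG) (k : K) : Prop :=
  ∀ inp, Q.Admissible G inp → ∀ t, 0 ≤ t → ∀ sent, IsRun A G k inp t sent →
    (∀ T : ℝ, {x : ℕ × ℕ × ℝ | x.2.2 ≤ T ∧ sent x.1 x.2.1 x.2.2 ≠ none}.Finite) ∧
    ∃ t', delay t t' ∧ (behaviour A G k inp t sent).SilentBefore t' ∧
      Q.Correct G inp t' (behaviour A G k inp t sent)

/-- The set of the problems solvable in every graph of the class with the given knowledge, where
the nodes may first prepare, during a finite time and with control messages only. -/
def Solvable (C : Context) : Set Problem :=
  {Q | ∃ A : Algorithm C.K Q.Input Q.Output, ∀ G k, C.Holds G k →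
    SolvesIn (fun t t' => t ≤ t') Q A G k}

/-- As `Solvable`, but without preparation: the problem posed at the start date of the execution
has to be solved. -/
def SolvableAtOnce (C : Context) : Set Problem :=
  {Q | ∃ A : Algorithm C.K Q.Input Q.Output, ∀ G k, C.Holds G k →
    SolvesIn (fun t t' => t' = t) Q A G k}

/-- Recurrent graphs, the number of nodes being known. -/
def contextRn : Context where
  K := ℕ
  Holds G n := G.Recurrent ∧ n = G.nodes.card

/-- Bounded-recurrent graphs, a bound on the recurrence time being known. -/
def contextBΔ : Context where
  K := ℝ
  Holds G Δ := G.BoundedRecurrent Δ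

/-- Periodic graphs, the period (or a multiple of it) being known. -/
def contextPp : Context where
  K := ℝ
  Holds G p := G.Periodic p

/-! ### Broadcast with termination detection -/

/-- `J` is a journey from `x` to `v`, departing at date `t` or later, along which the information
is transmitted. -/
def InfoJourney {Output : Type} (G : TVG) (β : Behaviour Output) (t : ℝ) (x : ℕ) (J : List Hop)
    (v : ℕ) : Prop :=
  IsJourney G.ζ (fun h => β.info h.src h.dst h.date ∧ G.Crossable h) t x J v

/-- Broadcast from an emitter `x` (the only node with input `true`) with termination detection at
the emitter, subject to a `criterion` on the dissemination of the information, which `x` holds from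
date `t` on. The output `some ()` of the emitter is its terminal state. The emitter does enter it,
never leaves it, and is in it only when all nodes have received the information. -/
def TDB (criterion : TVG → ℕ → ℝ → Behaviour Unit → Prop) : Problem where
  Input := Bool
  Output := Unit
  Admissible G inp := ∃ x ∈ G.nodes, ∀ v ∈ G.nodes, inp v = true ↔ v = x
  Correct G inp t β := ∀ x ∈ G.nodes, inp x = true →
    (∃ T, β.out x T = some ()) ∧
    (∀ T T', T ≤ T' → β.out x T = some () → β.out x T' = some ()) ∧
    (∀ T, β.out x T = some () →
      ∀ v ∈ G.nodes, ∃ J, InfoJourney G β t x J v ∧ arrival G.ζ t J ≤ T) ∧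
    criterion G x t β

/-- Each node receives the information (for the first time) along a journey which has the least
number of hops among all journeys from the emitter departing at date `t` or later. -/
def ShortestCriterion (G : TVG) (x : ℕ) (t : ℝ) (β : Behaviour Unit) : Prop :=
  ∀ v ∈ G.nodes, ∃ J, InfoJourney G β t x J v ∧
    (∀ J', InfoJourney G β t x J' v → arrival G.ζ t J ≤ arrival G.ζ t J') ∧
    ∀ J', G.Journey t x J' v → J.length ≤ J'.length

/-- The schedule of `G` allows a broadcast from `x` during the time interval `[a, b]`. -/
def BroadcastWindow (G : TVG) (x : ℕ) (a b : ℝ) : Prop :=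
  ∀ v ∈ G.nodes, ∃ J, G.Journey a x J v ∧ arrival G.ζ a J ≤ b

/-- Among the possible broadcasts from `x` that start at date `t` or later, the one during `[a, b]`
has the minimum duration. -/
def FastestWindow (G : TVG) (x : ℕ) (t a b : ℝ) : Prop :=
  t ≤ a ∧ BroadcastWindow G x a b ∧
    ∀ a' b', t ≤ a' → BroadcastWindow G x a' b' → b - a ≤ b' - a'

/-- The dissemination takes place during a time interval `[a, b]`: the emitter sends no information
before `a`, and all nodes have received it by date `b`. If there is a minimum duration for the
broadcasts that start at date `t` or later, then `[a, b]` is not longer than that. -/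
def FastestCriterion (G : TVG) (x : ℕ) (t : ℝ) (β : Behaviour Unit) : Prop :=
  ∃ a b, t ≤ a ∧ (∀ w s, β.info x w s → a ≤ s) ∧
    (∀ v ∈ G.nodes, ∃ J, InfoJourney G β a x J v ∧ arrival G.ζ a J ≤ b) ∧
    ∀ a₀ b₀, FastestWindow G x t a₀ b₀ → b - a ≤ b₀ - a₀

/-- Shortest broadcast with termination detection. -/
def TDBshortest : Problem := TDB ShortestCriterion

/-- Fastest broadcast with termination detection. -/
def TDBfastest : Problem := TDB FastestCriterion

end DynNet

namespace DynNet

/-! ### Appearances of edges -/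

namespace TVG

variable {G : TVG} {u v : ℕ}

/-! The inclusions compare knowledge. A period is itself a bound on the recurrence time
(`Periodic.boundedRecurrent`), which gives the right one. For the left one, nodes that know `Δ`
compute `n` and only then run the given algorithm. They flood observations by control messages in
rounds of length `Δ + ζ`, long enough for each edge to be crossed once. After `k` rounds a node
knows at least its ball of radius `k` in the footprint, which has more than `k` points while `k < n`
(`lt_ncard_ball`). Hence the number of observations is first at most the number of rounds at round
`n`, and this happens at all nodes together. They then start the algorithm at a common date
(`IsRun.collectThen_behaviour`). Sending only at ticks and appearances of edges keeps the messages
finite in number.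

The same flooding yields both positive results. Observing during `Δ` reveals the whole footprint. If
a node at distance `d` from the emitter waits for tick `d` before it forwards, then each node is
first reached from the preceding level, so along a shortest path (`exists_shortest_infoJourney`). In
a periodic graph, observing one period reveals the whole future, so all nodes can agree on one
fastest broadcast, delayed by whole periods until the collection is over (`fastPlan_chosenPlan`).

The negative results rest on causality: an execution up to `T` depends only on the graph up to `T`
(`IsRun.eq_of_agree`). Let a supposed algorithm inform all nodes by `T` in one graph, then change
the graph after `T`, with the same knowledge still correct, so that a better broadcast exists later.
With only `n` known, a direct edge can turn up late and shorten the path. With only `Δ` known, two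
contacts of the emitter that never overlapped can become simultaneous and shorten the duration. -/

theorem IsEdge.symm (h : G.IsEdge u v) : G.IsEdge v u := by
  unfold IsEdge at *
  rwa [G.pres_symm v u]

/-- The presence interval of length `ζ` around `s` cannot begin before `s`, where the edge is
absent; so it begins at `s`, and an appearing edge can be crossed at once. -/
theorem AppearsAt.icc_subset {s : ℝ} (h : G.AppearsAt u v s) :
    Set.Icc s (s + G.ζ) ⊆ G.pres u v := by
  obtain ⟨hs, ε, hε, hab⟩ := h
  obtain ⟨a, ha, hsub⟩ := G.pres_length u v s hs
  have has : a = s := by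
    by_contra hne
    have hlt : a < s := lt_of_le_of_ne ha.1 hne
    have h1 : max a (s - ε / 2) < s := max_lt hlt (by linarith)
    refine hab (max a (s - ε / 2)) ⟨?_, h1⟩ (hsub ⟨le_max_left _ _, ?_⟩)
    · exact lt_of_lt_of_le (by linarith) (le_max_right _ _)
    · linarith [ha.2]
  rwa [has] at hsub

theorem AppearsAt.add_lt {s s' : ℝ} (h : G.AppearsAt u v s) (h' : G.AppearsAt u v s')
    (hlt : s < s') : s + G.ζ < s' := by
  by_contra! hle
  obtain ⟨-, ε, hε, hab⟩ := h'
  have h1 : max s (s' - ε / 2) < s' := max_lt hlt (by linarith)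
  refine hab (max s (s' - ε / 2)) ⟨lt_of_lt_of_le (by linarith) (le_max_right _ _), h1⟩
    (h.icc_subset ⟨le_max_left _ _, by linarith⟩)

/-- Between a date of absence and a later date of presence, the edge appears. -/
theorem exists_appearsAt {r r' : ℝ} (hr : r ∉ G.pres u v) (hr' : r' ∈ G.pres u v) (hlt : r < r') :
    ∃ s, r < s ∧ s ≤ r' ∧ G.AppearsAt u v s := by
  have hcl : IsClosed (G.pres u v ∩ Set.Icc r r') := (G.pres_closed u v).inter isClosed_Icc
  have hne : (G.pres u v ∩ Set.Icc r r').Nonempty := ⟨r', hr', hlt.le, le_rfl⟩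
  have hbdd : BddBelow (G.pres u v ∩ Set.Icc r r') := ⟨r, fun x hx => hx.2.1⟩
  obtain ⟨h1, h2⟩ := hcl.csInf_mem hne hbdd
  set s := sInf (G.pres u v ∩ Set.Icc r r')
  have hrs : r < s := lt_of_le_of_ne h2.1 (fun h => hr (h ▸ h1))
  refine ⟨s, hrs, h2.2, h1, s - r, by linarith, fun x hx hxp => ?_⟩
  have : s ≤ x := csInf_le hbdd ⟨hxp, by linarith [hx.1], by linarith [hx.2, h2.2]⟩
  linarith [hx.2]

theorem neg_one_notMem : (-1 : ℝ) ∉ G.pres u v := fun h => by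
  linarith [G.pres_nonneg u v _ h]

/-- Appearances of an edge are more than `ζ` apart, so `s ↦ ⌊s / ζ⌋` is injective on them. -/
theorem finite_appearsAt (G : TVG) (u v : ℕ) (a b : ℝ) :
    {s | G.AppearsAt u v s ∧ a ≤ s ∧ s ≤ b}.Finite := by
  refine Set.Finite.of_finite_image (f := fun s => ⌊s / G.ζ⌋)
    ((Set.finite_Icc ⌊a / G.ζ⌋ ⌊b / G.ζ⌋).subset ?_) ?_
  · rintro _ ⟨s, ⟨-, h1, h2⟩, rfl⟩
    exact ⟨Int.floor_le_floor (div_le_div_of_nonneg_right h1 G.ζ_pos.le),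
      Int.floor_le_floor (div_le_div_of_nonneg_right h2 G.ζ_pos.le)⟩
  · have key : ∀ s s', G.AppearsAt u v s → G.AppearsAt u v s' → s < s' →
        ⌊s / G.ζ⌋ ≠ ⌊s' / G.ζ⌋ := by
      intro s s' h h' hlt heq
      have h1 := h.add_lt h' hlt
      have h2 : s / G.ζ + 1 < s' / G.ζ := by
        rw [lt_div_iff₀ G.ζ_pos, add_mul, div_mul_cancel₀ _ G.ζ_pos.ne']
        linarith
      have h3 := Int.lt_floor_add_one (s' / G.ζ)
      have h4 := Int.floor_le (s / G.ζ)
      rw [heq] at h4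
      linarith
    rintro s ⟨h, -⟩ s' ⟨h', -⟩ heq
    rcases lt_trichotomy s s' with hlt | h0 | hlt
    · exact absurd heq (key s s' h h' hlt)
    · exact h0
    · exact absurd heq.symm (key s' s h' h hlt)

/-- In every time window of length `Δ`, each edge can be crossed, from the beginning of the window
or from an appearance of the edge on. -/
theorem BoundedRecurrent.exists_crossing {Δ : ℝ} (h : G.BoundedRecurrent Δ) (he : G.IsEdge u v)
    {T : ℝ} (hT : 0 ≤ T) :
    ∃ s, T ≤ s ∧ s ≤ T + Δ ∧ Set.Icc s (s + G.ζ) ⊆ G.pres u v ∧ (s = T ∨ G.AppearsAt u v s) := by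
  obtain ⟨-, hΔ, hB⟩ := h
  obtain ⟨⟨s₀, hs₀, happ₀⟩, hnext⟩ := hB u v he
  by_cases hex : ∃ s, T < s ∧ s ≤ T + Δ ∧ G.AppearsAt u v s
  · obtain ⟨s, h1, h2, h3⟩ := hex
    exact ⟨s, h1.le, h2, h3.icc_subset, Or.inr h3⟩
  have hno : ∀ s, G.AppearsAt u v s → s ≤ T + Δ → s ≤ T := by
    intro s h1 h2
    by_contra! h3
    exact hex ⟨s, h3, h2, h1⟩
  -- No appearance falls in `(T, T + Δ]`. Take the last one, `s ≤ T`; an absence after `T` would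
  -- force another by `s + Δ`, hence by `T`, against the choice of `s`. So the edge is present from
  -- `T` on.
  have hfin := finite_appearsAt G u v 0 T
  obtain ⟨s, ⟨hs, hs0, hsT⟩, hmax⟩ := Set.exists_max_image _ id hfin
    ⟨s₀, happ₀, G.pres_nonneg _ _ _ happ₀.1, hno s₀ happ₀ (by linarith)⟩
  refine ⟨T, le_rfl, by linarith, fun r hr => ?_, Or.inl rfl⟩
  by_contra hr'
  have hsr : s < r := lt_of_le_of_ne (hsT.trans hr.1) (fun h => hr' (h ▸ hs.1))
  obtain ⟨s', h1, h2, h3⟩ := hnext s hs ⟨r, hsr, hr'⟩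
  have h4 : s' ≤ s := hmax s' ⟨h3, G.pres_nonneg _ _ _ h3.1, hno s' h3 (by linarith)⟩
  linarith

/-- Periodic graphs are bounded-recurrent, the period being a bound on the recurrence time. -/
theorem Periodic.boundedRecurrent {p : ℝ} (h : G.Periodic p) : G.BoundedRecurrent p := by
  obtain ⟨hc, hp, hper⟩ := h
  have hmod : ∀ r s : ℝ, s ≤ r → ∃ k : ℕ, s ≤ r - k * p ∧ r - k * p < s + p := by
    intro r s hsr
    have h0 : 0 ≤ (r - s) / p := div_nonneg (by linarith) hp.le
    refine ⟨⌊(r - s) / p⌋₊, ?_, ?_⟩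
    · have := Nat.floor_le h0
      rw [le_div_iff₀ hp] at this
      linarith
    · have := Nat.lt_floor_add_one ((r - s) / p)
      rw [div_lt_iff₀ hp, add_mul] at this
      linarith
  refine ⟨⟨hc, ?_⟩, hp, ?_⟩
  · rintro u v ⟨s, hs⟩ t ht -
    obtain ⟨k, hk⟩ := exists_nat_gt ((t - s) / p)
    rw [div_lt_iff₀ hp] at hk
    exact ⟨s + k * p, by linarith, (hper u v ⟨s, hs⟩ s (G.pres_nonneg _ _ _ hs) k).1 hs⟩
  · intro u v he
    constructor
    · obtain ⟨t, ht⟩ := he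
      have ht0 := G.pres_nonneg _ _ _ ht
      obtain ⟨k, h1, h2⟩ := hmod t 0 ht0
      have h3 : t - k * p ∈ G.pres u v :=
        (hper u v ⟨t, ht⟩ _ h1 k).2 (by rwa [sub_add_cancel])
      obtain ⟨s, -, hs, happ⟩ := exists_appearsAt neg_one_notMem h3 (by linarith)
      exact ⟨s, by linarith, happ⟩
    · rintro s hs ⟨r, hsr, hr⟩
      have hs0 := G.pres_nonneg _ _ _ hs.1
      obtain ⟨k, h1, h2⟩ := hmod r s hsr.le
      -- The absence at `r` is moved back into the period after `s`; since the edge is present again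
      -- at `s + p`, it appears in between.
      have h3 : r - k * p ∉ G.pres u v := fun h =>
        hr (by simpa using (hper u v he _ (hs0.trans h1) k).1 h)
      have h4 : s + p ∈ G.pres u v := by simpa using (hper u v he s hs0 1).1 hs.1
      obtain ⟨s', h5, h6, h7⟩ := exists_appearsAt h3 h4 h2
      exact ⟨s', by linarith, h6, h7⟩

end TVG

/-! ### Balls with respect to a relation -/

/-- The points that can be reached from `x` in at most `k` steps. -/
def ball (r : ℕ → ℕ → Prop) (x : ℕ) : ℕ → Set ℕ
  | 0 => {x}
  | k + 1 => ball r x k ∪ {u | ∃ w ∈ ball r x k, r w u}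

theorem ball_mono (r : ℕ → ℕ → Prop) (x : ℕ) : Monotone (ball r x) :=
  monotone_nat_of_le_succ fun _ => Set.subset_union_left

theorem mem_ball_succ_of_rel {r : ℕ → ℕ → Prop} {x u w k : ℕ} (h : w ∈ ball r x k) (hr : r w u) :
    u ∈ ball r x (k + 1) := Or.inr ⟨w, h, hr⟩

/-- Balls are built by adding a last step, but flooding needs the first one: a node learns what its
neighbour already knew. -/
theorem exists_first_step {r : ℕ → ℕ → Prop} {x u : ℕ} :
    ∀ {k : ℕ}, u ∈ ball r x (k + 1) → u ∈ ball r x k ∨ ∃ w, r x w ∧ u ∈ ball r w k := by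
  intro k
  induction k generalizing u with
  | zero =>
    rintro (h | ⟨w, h, hr⟩)
    · exact Or.inl h
    · obtain rfl : w = x := h
      exact Or.inr ⟨u, hr, rfl⟩
  | succ k ih =>
    rintro (h | ⟨w, h, hr⟩)
    · exact Or.inl h
    · rcases ih h with h | ⟨y, hy, h⟩
      · exact Or.inl (mem_ball_succ_of_rel h hr)
      · exact Or.inr ⟨y, hy, mem_ball_succ_of_rel h hr⟩

namespace TVG

variable {G : TVG}

theorem IsEdge.mem_nodes {u v : ℕ} (h : G.IsEdge u v) : u ∈ G.nodes ∧ v ∈ G.nodes :=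
  G.pres_nodes u v h

theorem ball_subset_nodes {x : ℕ} (hx : x ∈ G.nodes) (k : ℕ) : ball G.IsEdge x k ⊆ G.nodes := by
  induction k with
  | zero =>
    rintro u rfl
    exact hx
  | succ k ih =>
    rintro u (h | ⟨w, -, h⟩)
    · exact ih h
    · exact h.mem_nodes.2

theorem nodes_subset_of_closed (hc : G.footprint.Connected) {S : Set ℕ} {x : ℕ} (hx : x ∈ G.nodes)
    (hxS : x ∈ S) (hS : ∀ u ∈ S, ∀ v, G.IsEdge u v → v ∈ S) : ↑G.nodes ⊆ S := by
  intro v hv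
  obtain ⟨p⟩ := hc.preconnected ⟨x, hx⟩ ⟨v, hv⟩
  have : ∀ (a b : {v : ℕ // v ∈ G.nodes}), G.footprint.Walk a b → a.1 ∈ S → b.1 ∈ S := by
    intro a b p
    induction p with
    | nil => exact id
    | cons h _ ih => exact fun ha => ih (hS _ ha _ h)
  exact this _ _ p hxS

/-- A ball equal to the next one is closed under adjacency, hence is everything by connectedness;
until then each step adds a point. This makes counting a test of completeness. -/
theorem lt_ncard_ball (hc : G.footprint.Connected) {x : ℕ} (hx : x ∈ G.nodes) {k : ℕ}
    (hk : k < G.nodes.card) : k < (ball G.IsEdge x k).ncard := by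
  have hfin : ∀ k, (ball G.IsEdge x k).Finite := fun k =>
    G.nodes.finite_toSet.subset (ball_subset_nodes hx k)
  induction k with
  | zero => simp [ball]
  | succ k ih =>
    have h1 := ih (by omega)
    by_cases h : ball G.IsEdge x (k + 1) ⊆ ball G.IsEdge x k
    · have h2 : ↑G.nodes ⊆ ball G.IsEdge x k :=
        nodes_subset_of_closed hc hx (ball_mono _ _ (Nat.zero_le k) rfl)
          fun u hu v huv => h (mem_ball_succ_of_rel hu huv)
      have h3 := Set.ncard_le_ncard (h2.trans (ball_mono _ _ (Nat.le_add_right k 1))) (hfin _)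
      rw [Set.ncard_coe_finset] at h3
      omega
    · have := Set.ncard_lt_ncard
        (Set.ssubset_iff_subset_ne.2 ⟨ball_mono G.IsEdge x (Nat.le_add_right k 1),
          fun he => h he.symm.subset⟩) (hfin _)
      omega

theorem nodes_subset_ball (hc : G.footprint.Connected) {x : ℕ} (hx : x ∈ G.nodes) :
    ↑G.nodes ⊆ ball G.IsEdge x (G.nodes.card - 1) := by
  have hpos : 0 < G.nodes.card := Finset.card_pos.2 ⟨x, hx⟩
  have h := lt_ncard_ball hc hx (k := G.nodes.card - 1) (by omega)
  have h2 := Set.eq_of_subset_of_ncard_le (ball_subset_nodes hx (G.nodes.card - 1))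
    (by rw [Set.ncard_coe_finset]; omega) G.nodes.finite_toSet
  exact h2.symm.subset

end TVG

/-! ### Journeys -/

theorem arrival_cons (ζ t : ℝ) (h : Hop) (J : List Hop) :
    arrival ζ t (h :: J) = arrival ζ (h.date + ζ) J := by
  cases J with
  | nil => simp [arrival]
  | cons a l => simp [arrival, List.getLast?_eq_some_getLast]

theorem arrival_append_singleton (ζ t : ℝ) (h : Hop) (J : List Hop) :
    arrival ζ t (J ++ [h]) = h.date + ζ := by
  simp [arrival]

theorem arrival_mono_start {ζ t t' : ℝ} (h : t ≤ t') (J : List Hop) :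
    arrival ζ t J ≤ arrival ζ t' J := by
  cases J with
  | nil => simpa [arrival]
  | cons a l => rw [arrival_cons, arrival_cons]

theorem isJourney_append_singleton {ζ : ℝ} {ok : Hop → Prop} {h : Hop} {v : ℕ} {J : List Hop} :
    ∀ {t : ℝ} {u : ℕ}, IsJourney ζ ok t u (J ++ [h]) v ↔
      IsJourney ζ ok t u J h.src ∧ arrival ζ t J ≤ h.date ∧ ok h ∧ h.dst = v := by
  induction J with
  | nil =>
    intro t u
    simp only [List.nil_append, IsJourney, arrival, List.getLast?_nil]
    constructor
    · rintro ⟨h1, h2, h3, h4⟩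
      exact ⟨h1.symm, h2, h3, h4⟩
    · rintro ⟨h1, h2, h3, h4⟩
      exact ⟨h1.symm, h2, h3, h4⟩
  | cons a l ih =>
    intro t u
    simp only [List.cons_append, IsJourney, ih, arrival_cons]
    tauto

theorem IsJourney.mono_start {ζ t t' : ℝ} {ok : Hop → Prop} {u v : ℕ} {J : List Hop} (h : t ≤ t')
    (hJ : IsJourney ζ ok t' u J v) : IsJourney ζ ok t u J v := by
  cases J with
  | nil => exact hJ
  | cons a l => exact ⟨hJ.1, h.trans hJ.2.1, hJ.2.2⟩

theorem IsJourney.le_arrival {ζ : ℝ} (hζ : 0 < ζ) {ok : Hop → Prop} {v : ℕ} {J : List Hop} :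
    ∀ {t : ℝ} {u : ℕ}, IsJourney ζ ok t u J v → t ≤ arrival ζ t J := by
  induction J with
  | nil => intro t u _; simp [arrival]
  | cons a l ih =>
    rintro t u ⟨-, h2, -, h4⟩
    rw [arrival_cons]
    linarith [ih h4]

theorem IsJourney.imp {ζ : ℝ} (hζ : 0 < ζ) {ok ok' : Hop → Prop} {v : ℕ} {J : List Hop} :
    ∀ {t : ℝ} {u : ℕ}, (∀ h ∈ J, t ≤ h.date → ok h → ok' h) → IsJourney ζ ok t u J v →
      IsJourney ζ ok' t u J v := by
  induction J with
  | nil => exact fun _ h => h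
  | cons a l ih =>
    rintro t u hi ⟨h1, h2, h3, h4⟩
    exact ⟨h1, h2, hi a (by simp) h2 h3,
      ih (fun h hh hd => hi h (by simp [hh]) (by linarith)) h4⟩

theorem IsJourney.le_date {ζ : ℝ} (hζ : 0 < ζ) {ok : Hop → Prop} {v : ℕ} {J : List Hop} :
    ∀ {t : ℝ} {u : ℕ}, IsJourney ζ ok t u J v → ∀ h ∈ J, t ≤ h.date := by
  induction J with
  | nil => simp
  | cons a l ih =>
    rintro t u ⟨h1, h2, h3, h4⟩ h hh
    rcases List.mem_cons.1 hh with rfl | hh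
    · exact h2
    · linarith [ih h4 h hh]

theorem IsJourney.exists_last {ζ t : ℝ} {ok : Hop → Prop} {u v : ℕ} {J : List Hop}
    (hJ : IsJourney ζ ok t u J v) (huv : u ≠ v) :
    ∃ J' h, J = J' ++ [h] ∧ IsJourney ζ ok t u J' h.src ∧ arrival ζ t J' ≤ h.date ∧ ok h ∧
      h.dst = v := by
  rcases List.eq_nil_or_concat J with rfl | ⟨J', h, rfl⟩
  · exact absurd hJ huv
  · rw [List.concat_eq_append] at hJ ⊢
    exact ⟨J', h, rfl, isJourney_append_singleton.1 hJ⟩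

/-- Bounds the number of hops below by the distance, whatever the dates are. -/
theorem IsJourney.mem_ball {ζ t : ℝ} {ok : Hop → Prop} {r : ℕ → ℕ → Prop}
    (hr : ∀ h, ok h → r h.src h.dst) {x v : ℕ} {J : List Hop} (hJ : IsJourney ζ ok t x J v) :
    v ∈ ball r x J.length := by
  induction J using List.reverseRecOn generalizing v with
  | nil => exact Eq.symm hJ
  | append_singleton J h ih =>
    obtain ⟨h1, -, h3, rfl⟩ := isJourney_append_singleton.1 hJ
    rw [List.length_append]
    exact mem_ball_succ_of_rel (ih h1) (hr h h3)

namespace TVG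

variable {G : TVG}

theorem Crossable.isEdge {h : Hop} (hc : G.Crossable h) : G.IsEdge h.src h.dst :=
  ⟨h.date, hc ⟨le_rfl, by linarith [G.ζ_pos]⟩⟩

theorem BoundedRecurrent.exists_journey {Δ : ℝ} (hG : G.BoundedRecurrent Δ) {x : ℕ} {t : ℝ}
    (ht : 0 ≤ t) {k v : ℕ} (hv : v ∈ ball G.IsEdge x k) : ∃ J, G.Journey t x J v := by
  induction k generalizing v with
  | zero => exact ⟨[], Eq.symm hv⟩
  | succ k ih =>
    rcases hv with hv | ⟨w, hw, he⟩
    · exact ih hv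
    · obtain ⟨J, hJ⟩ := ih hw
      obtain ⟨s, h1, -, h3, -⟩ :=
        hG.exists_crossing he (ht.trans (IsJourney.le_arrival G.ζ_pos hJ))
      exact ⟨J ++ [Hop.mk w v s],
        (isJourney_append_singleton (h := ⟨w, v, s⟩) (v := v)).2 ⟨hJ, h1, h3, rfl⟩⟩

end TVG

/-! ### Sending at ticks and at appearances -/

/-- The `k`-th tick of a clock that starts at `b`: two ticks leave enough time for an edge to appear
and to be crossed. -/
def tick (Δ ζ b : ℝ) (k : ℕ) : ℝ := b + k * (Δ + ζ)

theorem tick_zero (Δ ζ b : ℝ) : tick Δ ζ b 0 = b := by simp [tick]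

theorem tick_succ (Δ ζ b : ℝ) (k : ℕ) : tick Δ ζ b (k + 1) = tick Δ ζ b k + Δ + ζ := by
  simp only [tick]
  push_cast
  ring

theorem tick_strictMono {Δ ζ : ℝ} (hΔ : 0 < Δ) (hζ : 0 < ζ) (b : ℝ) : StrictMono (tick Δ ζ b) :=
  strictMono_nat_of_lt_succ fun k => by
    rw [tick_succ]
    linarith

theorem le_tick {Δ ζ : ℝ} (hΔ : 0 < Δ) (hζ : 0 < ζ) (b : ℝ) (k : ℕ) : b ≤ tick Δ ζ b k := by
  have := (tick_strictMono hΔ hζ b).monotone (Nat.zero_le k)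
  rwa [tick_zero] at this

/-- The edge to `w` is present, the clock started at `b` runs, and now it ticks or the edge appears
(as far as the node can see). -/
def View.Fires {K Input Msg : Type} (V : View K Input Msg) (Δ b : ℝ) (w : ℕ) : Prop :=
  V.now ∈ V.seen w ∧ b ≤ V.now ∧
    ((∃ k, V.now = tick Δ V.ζ b k) ∨ ∃ ε > 0, ∀ r ∈ Set.Ioo (V.now - ε) V.now, r ∉ V.seen w)

/-- The edge from `v` to `w` is present at date `t`, the clock started at `b` runs, and now it ticks
or the edge appears. -/
def TVG.FiresAt (G : TVG) (Δ b : ℝ) (v w : ℕ) (t : ℝ) : Prop :=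
  t ∈ G.pres v w ∧ b ≤ t ∧ ((∃ k, t = tick Δ G.ζ b k) ∨ G.AppearsAt v w t)

/-- A node sees nothing before `t₀`, so an edge already present then looks as if it appeared. This
does no harm: `b` itself is a tick, and after `b ≥ t₀` a left neighbourhood of the present date is
visible. -/
theorem fires_viewAt {K Input Msg : Type} {G : TVG} {κ : K} {inp : ℕ → Input} {t₀ : ℝ}
    {sent : ℕ → ℕ → ℝ → Option (Bool × Msg)} {v w : ℕ} {t Δ b : ℝ} (hb : t₀ ≤ b) :
    (viewAt G κ inp t₀ sent v t).Fires Δ b w ↔ G.FiresAt Δ b v w t := by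
  simp only [View.Fires, TVG.FiresAt, viewAt, Set.mem_inter_iff, Set.mem_Icc]
  constructor
  · rintro ⟨⟨h1, h2, -⟩, h3, h4⟩
    refine ⟨h1, h3, ?_⟩
    rcases h4 with h4 | ⟨ε, hε, h4⟩
    · exact Or.inl h4
    · rcases h3.eq_or_lt with h5 | h5
      · exact Or.inl ⟨0, by rw [tick_zero, h5]⟩
      · refine Or.inr ⟨h1, min ε (t - b), lt_min hε (by linarith), fun r hr hrp => ?_⟩
        have h6 := min_le_left ε (t - b)
        have h7 := min_le_right ε (t - b)
        exact h4 r ⟨by linarith [hr.1], hr.2⟩ ⟨hrp, by linarith [hr.1], hr.2.le⟩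
  · rintro ⟨h1, h3, h4⟩
    refine ⟨⟨h1, by linarith, le_rfl⟩, h3, h4.imp id ?_⟩
    rintro ⟨-, ε, hε, h⟩
    exact ⟨ε, hε, fun r hr hrp => h r hr hrp.1⟩

namespace TVG

variable {G : TVG}

theorem finite_firesAt (G : TVG) {Δ : ℝ} (hΔ : 0 < Δ) (b T : ℝ) :
    {x : ℕ × ℕ × ℝ | G.FiresAt Δ b x.1 x.2.1 x.2.2 ∧ x.2.2 ≤ T}.Finite := by
  have h1 : {k : ℕ | tick Δ G.ζ b k ≤ T}.Finite := by
    refine (Set.finite_Iic ⌈(T - b) / (Δ + G.ζ)⌉₊).subset fun k hk => ?_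
    have h2 : (k : ℝ) ≤ (T - b) / (Δ + G.ζ) := by
      rw [le_div_iff₀ (by linarith [G.ζ_pos])]
      simp only [tick, Set.mem_ofPred_eq] at hk
      linarith
    exact Nat.cast_le.1 (h2.trans (Nat.le_ceil _))
  have h2 : ∀ u v, {s | G.AppearsAt u v s ∧ b ≤ s ∧ s ≤ T}.Finite := fun u v =>
    finite_appearsAt G u v b T
  have h3 : (⋃ u ∈ G.nodes, ⋃ v ∈ G.nodes, (fun s => (u, v, s)) ''
      (tick Δ G.ζ b '' {k | tick Δ G.ζ b k ≤ T} ∪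
        {s | G.AppearsAt u v s ∧ b ≤ s ∧ s ≤ T})).Finite :=
    G.nodes.finite_toSet.biUnion fun u _ => G.nodes.finite_toSet.biUnion fun v _ =>
      ((h1.image _).union (h2 u v)).image _
  refine h3.subset ?_
  rintro ⟨u, v, s⟩ ⟨⟨hp, hb, hs⟩, hT⟩
  have huv := G.pres_nodes u v ⟨s, hp⟩
  simp only [Set.mem_iUnion]
  refine ⟨u, huv.1, v, huv.2, s, ?_, rfl⟩
  rcases hs with ⟨k, hk⟩ | hs
  · exact Or.inl ⟨k, by rw [Set.mem_ofPred_eq, ← hk]; exact hT, hk.symm⟩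
  · exact Or.inr ⟨hs, hb, hT⟩

/-- Between two ticks, each edge can be crossed from a date on at which messages are sent. -/
theorem BoundedRecurrent.exists_firesAt {Δ b : ℝ} (h : G.BoundedRecurrent Δ) (hb : 0 ≤ b) {u v : ℕ}
    (he : G.IsEdge u v) (k : ℕ) :
    ∃ s, tick Δ G.ζ b k ≤ s ∧ s + G.ζ ≤ tick Δ G.ζ b (k + 1) ∧
      Set.Icc s (s + G.ζ) ⊆ G.pres u v ∧ G.FiresAt Δ b u v s := by
  have hbk := le_tick h.2.1 G.ζ_pos b k
  obtain ⟨s, h1, h2, h3, h4⟩ := h.exists_crossing he (hb.trans hbk)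
  refine ⟨s, h1, ?_, h3, h3 ⟨le_rfl, by linarith [G.ζ_pos]⟩, hbk.trans h1,
    h4.imp (fun h => ⟨k, h⟩) id⟩
  rw [tick_succ]
  linarith

end TVG

/-! ### Collecting local observations before running an algorithm -/

/-- What a node can tell about itself: its identifier, its input, and the dates at which the edges
to the other nodes were present. -/
abbrev Obs (Input : Type) := ℕ × Input × (ℕ → Set ℝ)

/-- The observations made by `v` between the dates `t₀` and `t₀ + Δ`. -/
def TVG.obs {Input : Type} (G : TVG) (inp : ℕ → Input) (t₀ Δ : ℝ) (v : ℕ) : Obs Input :=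
  (v, inp v, fun w => G.pres v w ∩ Set.Icc t₀ (t₀ + Δ))

theorem TVG.obs_injective {Input : Type} (G : TVG) (inp : ℕ → Input) (t₀ Δ : ℝ) :
    Function.Injective (G.obs inp t₀ Δ) := fun _ _ h => congrArg Prod.fst h

section Collect

variable {K₂ Input Output M : Type}

/-- The node's own observations. -/
def View.ownObs (V : View ℝ Input M) : Obs Input :=
  (V.id, V.input, fun w => V.seen w ∩ Set.Iic (V.start + V.knowledge))

/-- The observations known to the node at date `τ`. -/
def View.gathered (V : View ℝ Input (Set (Obs Input) ⊕ M)) (τ : ℝ) : Set (Obs Input) :=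
  {o | o = V.ownObs ∨ ∃ w s c m, s ≤ τ ∧ V.inbox w s = some (c, Sum.inl m) ∧ o ∈ m}

/-- The ticks during the collecting phase. -/
def View.collectTick (V : View ℝ Input M) (k : ℕ) : ℝ :=
  tick V.knowledge V.ζ (V.start + V.knowledge) k

/-- At the `k`-th tick the node knew at most `k` observations. -/
def View.Ready (V : View ℝ Input (Set (Obs Input) ⊕ M)) (k : ℕ) : Prop :=
  V.collectTick k ≤ V.now ∧ (V.gathered (V.collectTick k)).ncard ≤ k

/-- The messages that belong to the second phase. -/
def secondPhase {S : Type} (o : Option (Bool × (S ⊕ M))) : Option (Bool × M) :=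
  o.bind fun p => p.2.elim (fun _ => none) fun m => some (p.1, m)

/-- The view in the second phase, which starts at the `k`-th tick. -/
def View.subview (κ : ℝ → ℝ → ℝ → ℝ → Set (Obs Input) → K₂)
    (V : View ℝ Input (Set (Obs Input) ⊕ M)) (k : ℕ) : View K₂ Input M where
  id := V.id
  input := V.input
  knowledge :=
    κ V.knowledge V.ζ V.start (V.collectTick k) (V.gathered (V.collectTick k))
  ζ := V.ζ
  start := V.collectTick k
  now := V.now
  seen w := V.seen w ∩ Set.Ici (V.collectTick k)
  inbox w s := secondPhase (V.inbox w s)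

open Classical in
/-- First flood the observations of all nodes with control messages, until the numbers of ticks and
of observations are the same; then run `A`, with the knowledge computed by `κ` from the bound `Δ`,
the crossing delay, the start dates of both phases and the set of all observations. -/
noncomputable def collectThen (κ : ℝ → ℝ → ℝ → ℝ → Set (Obs Input) → K₂)
    (A : Algorithm K₂ Input Output) : Algorithm ℝ Input Output where
  Msg := Set (Obs Input) ⊕ A.Msg
  send V w :=
    -- Readiness at `k` is judged on what was gathered by the `k`-th tick, so the least ready `k`
    -- stays the same at later dates.
    if h : ∃ k, V.Ready k then
      (A.send (V.subview κ (Nat.find h)) w).map fun p => (p.1, Sum.inr p.2)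
    else if V.Fires V.knowledge (V.start + V.knowledge) w then
      some (false, Sum.inl (V.gathered V.now))
    else none
  output V := if h : ∃ k, V.Ready k then A.output (V.subview κ (Nat.find h)) else none

theorem secondPhase_map_inr {S : Type} (o : Option (Bool × M)) :
    secondPhase (S := S) (o.map fun p => (p.1, Sum.inr p.2)) = o := by
  cases o <;> simp [secondPhase]

/-- The observations known to `v` at date `τ`. -/
def gath (G : TVG) (inp : ℕ → Input) (t₀ Δ : ℝ)
    (sent : ℕ → ℕ → ℝ → Option (Bool × (Set (Obs Input) ⊕ M))) (v : ℕ) (τ : ℝ) :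
    Set (Obs Input) :=
  {o | o = G.obs inp t₀ Δ v ∨ ∃ w s c m, s ≤ τ ∧ Set.Icc (s - G.ζ) s ⊆ G.pres w v ∧
    sent w v (s - G.ζ) = some (c, Sum.inl m) ∧ o ∈ m}

variable {G : TVG} {inp : ℕ → Input} {t₀ Δ : ℝ}
  {sent : ℕ → ℕ → ℝ → Option (Bool × (Set (Obs Input) ⊕ M))}

theorem gath_mono (v : ℕ) : Monotone (gath G inp t₀ Δ sent v) := by
  rintro τ τ' h o (ho | ⟨w, s, c, m, h1, h2⟩)
  · exact Or.inl ho
  · exact Or.inr ⟨w, s, c, m, h1.trans h, h2⟩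

/-- Own observations are cut off at `t₀ + Δ` and receptions at `τ`, so the answer does not depend on
the later date `t` of asking. -/
theorem gathered_viewAt {v : ℕ} {t τ : ℝ} (ht : t₀ + Δ ≤ t) (hτ : τ ≤ t) :
    (viewAt G Δ inp t₀ sent v t).gathered τ = gath G inp t₀ Δ sent v τ := by
  have h0 : (viewAt G Δ inp t₀ sent v t).ownObs = G.obs inp t₀ Δ v := by
    simp only [View.ownObs, viewAt, TVG.obs, Prod.mk.injEq, true_and]
    funext w
    ext r
    simp only [Set.mem_inter_iff, Set.mem_Icc, Set.mem_Iic]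
    constructor
    · rintro ⟨⟨h1, h2, -⟩, h3⟩
      exact ⟨h1, h2, h3⟩
    · rintro ⟨h1, h2, h3⟩
      exact ⟨⟨h1, h2, h3.trans ht⟩, h3⟩
  ext o
  simp only [View.gathered, gath, h0, Set.mem_ofPred_eq]
  refine or_congr Iff.rfl ⟨?_, ?_⟩
  · rintro ⟨w, s, c, m, h1, h2, h3⟩
    simp only [viewAt] at h2
    split_ifs at h2 with h4
    exact ⟨w, s, c, m, h1, h4.2, h2, h3⟩
  · rintro ⟨w, s, c, m, h1, h2, h3, h4⟩
    refine ⟨w, s, c, m, h1, ?_, h4⟩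
    simp only [viewAt]
    rwa [if_pos ⟨h1.trans hτ, h2⟩]

theorem ready_viewAt {v k : ℕ} {t : ℝ} (hΔ : 0 < Δ) :
    (viewAt G Δ inp t₀ sent v t).Ready k ↔ tick Δ G.ζ (t₀ + Δ) k ≤ t ∧
      (gath G inp t₀ Δ sent v (tick Δ G.ζ (t₀ + Δ) k)).ncard ≤ k := by
  have h0 : (viewAt G Δ inp t₀ sent v t).collectTick k = tick Δ G.ζ (t₀ + Δ) k := rfl
  have h1 : (viewAt G Δ inp t₀ sent v t).now = t := rfl
  simp only [View.Ready, h0, h1]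
  refine and_congr_right fun h => ?_
  rw [gathered_viewAt ((le_tick hΔ G.ζ_pos _ k).trans h) h]

end Collect

/-! ### Correctness of the collecting phase -/

section CollectRun

variable {K₂ Input Output : Type} {κ : ℝ → ℝ → ℝ → ℝ → Set (Obs Input) → K₂}
  {A : Algorithm K₂ Input Output} {G : TVG} {inp : ℕ → Input} {t₀ Δ : ℝ}
  {sent : ℕ → ℕ → ℝ → Option (Bool × (Set (Obs Input) ⊕ A.Msg))}

/-- A message of the first phase contains what the sender knows. -/
theorem IsRun.eq_of_inl (hrun : IsRun (collectThen κ A) G Δ inp t₀ sent) (hΔ : 0 < Δ)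
    {v w : ℕ} {s : ℝ} {c : Bool} {m : Set (Obs Input)} (h : sent v w s = some (c, Sum.inl m)) :
    s ∈ G.pres v w ∧ t₀ ≤ s ∧ c = false ∧ m = gath G inp t₀ Δ sent v s ∧
      G.FiresAt Δ (t₀ + Δ) v w s := by
  rw [hrun v w s] at h
  split_ifs at h with h1
  simp only [collectThen] at h
  split_ifs at h with h2 h3
  · obtain ⟨p, -, hp⟩ := Option.map_eq_some_iff.1 h
    simp at hp
  · rw [Option.some_inj, Prod.mk.injEq, Sum.inl.injEq] at h
    have h4 : G.FiresAt Δ (t₀ + Δ) v w s := (fires_viewAt (by linarith)).1 h3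
    refine ⟨h1.2, h1.1, h.1.symm, ?_, h4⟩
    rw [← h.2]
    exact gathered_viewAt h4.2.1 le_rfl

/-- Induction over time in steps of `ζ`: what is received by `τ` was known to a node by `τ - ζ`. -/
theorem IsRun.gath_subset (hrun : IsRun (collectThen κ A) G Δ inp t₀ sent) (hΔ : 0 < Δ)
    {v : ℕ} (hv : v ∈ G.nodes) (τ : ℝ) :
    gath G inp t₀ Δ sent v τ ⊆ G.obs inp t₀ Δ '' G.nodes := by
  have key : ∀ N : ℕ, ∀ v ∈ G.nodes, ∀ τ, τ < t₀ + N * G.ζ →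
      gath G inp t₀ Δ sent v τ ⊆ G.obs inp t₀ Δ '' G.nodes := by
    intro N
    induction N with
    | zero =>
      rintro v hv τ hτ o (rfl | ⟨w, s, c, m, h1, h2, h3, h4⟩)
      · exact ⟨v, hv, rfl⟩
      · have := (hrun.eq_of_inl hΔ h3).2.1
        simp only [Nat.cast_zero, zero_mul, add_zero] at hτ
        linarith [G.ζ_pos]
    | succ N ih =>
      rintro v hv τ hτ o (rfl | ⟨w, s, c, m, h1, h2, h3, h4⟩)
      · exact ⟨v, hv, rfl⟩
      · obtain ⟨h5, -, -, rfl, -⟩ := hrun.eq_of_inl hΔ h3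
        push_cast at hτ
        exact ih w (G.pres_nodes w v ⟨_, h5⟩).1 _ (by linarith) h4
  obtain ⟨N, hN⟩ := exists_nat_gt ((τ - t₀) / G.ζ)
  rw [div_lt_iff₀ G.ζ_pos] at hN
  exact key N v hv τ (by linarith)

/-- At each tick `j ≤ k` the node knows at least its ball of radius `j`, and this has more than `j`
points because `j < n`. So the test fails up to tick `k`, and the node is still collecting until
tick `k + 1`. -/
theorem IsRun.not_ready (hrun : IsRun (collectThen κ A) G Δ inp t₀ sent) (hΔ : 0 < Δ)
    (hc : G.footprint.Connected) {k : ℕ} (hk : k < G.nodes.card)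
    (ih : ∀ j ≤ k, ∀ v ∈ G.nodes, G.obs inp t₀ Δ '' ball G.IsEdge v j ⊆
      gath G inp t₀ Δ sent v (tick Δ G.ζ (t₀ + Δ) j))
    {v : ℕ} (hv : v ∈ G.nodes) {t : ℝ} (ht : t < tick Δ G.ζ (t₀ + Δ) (k + 1)) :
    ¬ ∃ j, (viewAt G Δ inp t₀ sent v t).Ready j := by
  rintro ⟨j, hj⟩
  obtain ⟨h1, h2⟩ := (ready_viewAt hΔ).1 hj
  have hjk : j < k + 1 := (tick_strictMono hΔ G.ζ_pos _).lt_iff_lt.1 (h1.trans_lt ht)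
  have h3 := TVG.lt_ncard_ball hc hv (k := j) (by omega)
  have h4 := Set.ncard_le_ncard (ih j (by omega) v hv)
    ((G.nodes.finite_toSet.image _).subset (hrun.gath_subset hΔ hv _))
  rw [Set.ncard_image_of_injective _ (G.obs_injective inp t₀ Δ)] at h4
  omega

/-- Each round relies on `IsRun.not_ready`: up to tick `k + 1` a neighbour `w` is still in the first
phase, so between the two ticks it sends all that it knew at tick `k`, including its own ball of
radius `k`. -/
theorem IsRun.ball_subset_gath (hrun : IsRun (collectThen κ A) G Δ inp t₀ sent) (ht₀ : 0 ≤ t₀)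
    (hG : G.BoundedRecurrent Δ) {k : ℕ} (hk : k ≤ G.nodes.card) :
    ∀ j ≤ k, ∀ v ∈ G.nodes, G.obs inp t₀ Δ '' ball G.IsEdge v j ⊆
      gath G inp t₀ Δ sent v (tick Δ G.ζ (t₀ + Δ) j) := by
  have hΔ := hG.2.1
  induction k with
  | zero =>
    rintro j hj v hv _ ⟨u, hu, rfl⟩
    obtain rfl : j = 0 := by omega
    obtain rfl : u = v := hu
    exact Or.inl rfl
  | succ k ih =>
    have ih' := ih (by omega)
    intro j hj v hv
    rcases hj.lt_or_eq with hj | rfl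
    · exact ih' j (by omega) v hv
    rintro _ ⟨u, hu, rfl⟩
    rcases exists_first_step hu with hu | ⟨w, hw, hu⟩
    · exact gath_mono v ((tick_strictMono hΔ G.ζ_pos _).monotone (Nat.le_add_right k 1))
        (ih' k le_rfl v hv ⟨u, hu, rfl⟩)
    · obtain ⟨s, h1, h2, h3, h4⟩ :=
        hG.exists_firesAt (b := t₀ + Δ) (by linarith) hw.symm k
      have hwn := hw.mem_nodes.2
      have hnr := hrun.not_ready hΔ hG.1.1 (by omega) ih' hwn (t := s)
        (by linarith [G.ζ_pos])
      refine Or.inr ⟨w, s + G.ζ, false, gath G inp t₀ Δ sent w s, h2, ?_, ?_, ?_⟩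
      · rwa [add_sub_cancel_right]
      · rw [add_sub_cancel_right, hrun w v s, if_pos ⟨by linarith [h4.2.1], h4.1⟩]
        simp only [collectThen]
        rw [dif_neg hnr, if_pos]
        · congr 3
          exact gathered_viewAt h4.2.1 le_rfl
        · exact (fires_viewAt (b := t₀ + Δ) (by linarith)).2 h4
      · exact gath_mono w h1 (ih' k le_rfl w hwn ⟨u, hu, rfl⟩)

theorem IsRun.gath_eq (hrun : IsRun (collectThen κ A) G Δ inp t₀ sent) (ht₀ : 0 ≤ t₀)
    (hG : G.BoundedRecurrent Δ) {v : ℕ} (hv : v ∈ G.nodes) :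
    gath G inp t₀ Δ sent v (tick Δ G.ζ (t₀ + Δ) G.nodes.card) = G.obs inp t₀ Δ '' G.nodes := by
  refine (hrun.gath_subset hG.2.1 hv _).antisymm
    (subset_trans (Set.image_mono ?_) (hrun.ball_subset_gath ht₀ hG le_rfl _ le_rfl v hv))
  exact (TVG.nodes_subset_ball hG.1.1 hv).trans (ball_mono _ _ (Nat.sub_le _ _))

theorem IsRun.not_ready_of_lt (hrun : IsRun (collectThen κ A) G Δ inp t₀ sent) (ht₀ : 0 ≤ t₀)
    (hG : G.BoundedRecurrent Δ) {v : ℕ} (hv : v ∈ G.nodes) {t : ℝ}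
    (ht : t < tick Δ G.ζ (t₀ + Δ) G.nodes.card) :
    ¬ ∃ j, (viewAt G Δ inp t₀ sent v t).Ready j := by
  have hpos : 0 < G.nodes.card := Finset.card_pos.2 ⟨v, hv⟩
  exact hrun.not_ready (k := G.nodes.card - 1) hG.2.1 hG.1.1 (by omega)
    (hrun.ball_subset_gath ht₀ hG (by omega)) hv (by rwa [Nat.sub_add_cancel hpos])

open Classical in
-- At tick `n` exactly `n` observations are known, and the test has failed before. As `n` does not
-- depend on the node, all nodes switch at the same date.
theorem IsRun.find_ready (hrun : IsRun (collectThen κ A) G Δ inp t₀ sent) (ht₀ : 0 ≤ t₀)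
    (hG : G.BoundedRecurrent Δ) {v : ℕ} (hv : v ∈ G.nodes) {t : ℝ}
    (ht : tick Δ G.ζ (t₀ + Δ) G.nodes.card ≤ t) :
    ∃ h : ∃ j, (viewAt G Δ inp t₀ sent v t).Ready j, Nat.find h = G.nodes.card := by
  have hΔ := hG.2.1
  have hr : (viewAt G Δ inp t₀ sent v t).Ready G.nodes.card := by
    refine (ready_viewAt hΔ).2 ⟨ht, ?_⟩
    rw [hrun.gath_eq ht₀ hG hv, Set.ncard_image_of_injective _ (G.obs_injective inp t₀ Δ),
      Set.ncard_coe_finset]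
  refine ⟨⟨_, hr⟩, (Nat.find_eq_iff _).2 ⟨hr, fun j hj hjr => ?_⟩⟩
  obtain ⟨h1, h2⟩ := (ready_viewAt hΔ).1 hjr
  exact hrun.not_ready_of_lt ht₀ hG hv (tick_strictMono hΔ G.ζ_pos _ hj)
    ⟨j, (ready_viewAt hΔ).2 ⟨le_rfl, h2⟩⟩

/-- Lets the second-phase messages form an execution in the sense of `IsRun`, where nothing is sent
before the start. -/
theorem IsRun.secondPhase_eq_none (hrun : IsRun (collectThen κ A) G Δ inp t₀ sent) (ht₀ : 0 ≤ t₀)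
    (hG : G.BoundedRecurrent Δ) {v w : ℕ} {t : ℝ}
    (ht : t < tick Δ G.ζ (t₀ + Δ) G.nodes.card) : secondPhase (sent v w t) = none := by
  rw [hrun v w t]
  split_ifs with h
  · simp only [collectThen]
    rw [dif_neg (hrun.not_ready_of_lt ht₀ hG (G.pres_nodes v w ⟨t, h.2⟩).1 ht)]
    split_ifs <;> rfl
  · rfl

theorem IsRun.subview_eq (hrun : IsRun (collectThen κ A) G Δ inp t₀ sent) (ht₀ : 0 ≤ t₀)
    (hG : G.BoundedRecurrent Δ) {v : ℕ} (hv : v ∈ G.nodes) {t : ℝ}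
    (ht : tick Δ G.ζ (t₀ + Δ) G.nodes.card ≤ t) :
    (viewAt G Δ inp t₀ sent v t).subview κ G.nodes.card =
      viewAt G (κ Δ G.ζ t₀ (tick Δ G.ζ (t₀ + Δ) G.nodes.card) (G.obs inp t₀ Δ '' G.nodes)) inp
        (tick Δ G.ζ (t₀ + Δ) G.nodes.card) (fun u w s => secondPhase (sent u w s)) v t := by
  have hΔ := hG.2.1
  have h0 : (viewAt G Δ inp t₀ sent v t).collectTick G.nodes.card =
    tick Δ G.ζ (t₀ + Δ) G.nodes.card := rfl
  have hle := le_tick hΔ G.ζ_pos (t₀ + Δ) G.nodes.card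
  have h1 := gathered_viewAt (G := G) (inp := inp) (sent := sent) (v := v) (hle.trans ht) ht
  rw [hrun.gath_eq ht₀ hG hv] at h1
  simp only [View.subview, h0, h1]
  simp only [viewAt, View.mk.injEq, true_and]
  constructor
  · funext w
    ext r
    simp only [Set.mem_inter_iff, Set.mem_Icc, Set.mem_Ici]
    constructor
    · rintro ⟨⟨h2, -, h4⟩, h5⟩
      exact ⟨h2, h5, h4⟩
    · rintro ⟨h2, h3, h4⟩
      exact ⟨⟨h2, by linarith, h4⟩, h3⟩
  · funext w s
    split_ifs <;> rfl

/-- In a bounded-recurrent graph, `collectThen κ A` behaves like `A` started at a later date. -/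
theorem IsRun.collectThen_behaviour (hrun : IsRun (collectThen κ A) G Δ inp t₀ sent) (ht₀ : 0 ≤ t₀)
    (hG : G.BoundedRecurrent Δ) :
    ∃ t₁ sent₁, t₀ ≤ t₁ ∧
      IsRun A G (κ Δ G.ζ t₀ t₁ (G.obs inp t₀ Δ '' G.nodes)) inp t₁ sent₁ ∧
      behaviour (collectThen κ A) G Δ inp t₀ sent =
        behaviour A G (κ Δ G.ζ t₀ t₁ (G.obs inp t₀ Δ '' G.nodes)) inp t₁ sent₁ ∧
      ∀ T : ℝ, {x : ℕ × ℕ × ℝ | x.2.2 ≤ T ∧ sent₁ x.1 x.2.1 x.2.2 ≠ none}.Finite →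
        {x : ℕ × ℕ × ℝ | x.2.2 ≤ T ∧ sent x.1 x.2.1 x.2.2 ≠ none}.Finite := by
  have hΔ := hG.2.1
  have hle : t₀ ≤ tick Δ G.ζ (t₀ + Δ) G.nodes.card := by
    linarith [le_tick hΔ G.ζ_pos (t₀ + Δ) G.nodes.card]
  refine ⟨tick Δ G.ζ (t₀ + Δ) G.nodes.card, fun u w s => secondPhase (sent u w s), hle,
    ?_, ?_, ?_⟩
  · intro v w t
    split_ifs with h
    · have hv := (G.pres_nodes v w ⟨t, h.2⟩).1
      obtain ⟨hr, hf⟩ := hrun.find_ready ht₀ hG hv h.1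
      change secondPhase (sent v w t) = _
      rw [hrun v w t, if_pos ⟨hle.trans h.1, h.2⟩]
      simp only [collectThen]
      rw [dif_pos hr, secondPhase_map_inr, hf, hrun.subview_eq ht₀ hG hv h.1]
    · rcases lt_or_ge t (tick Δ G.ζ (t₀ + Δ) G.nodes.card) with h1 | h1
      · exact hrun.secondPhase_eq_none ht₀ hG h1
      · change secondPhase (sent v w t) = _
        rw [hrun v w t, if_neg fun h2 => h ⟨h1, h2.2⟩]
        rfl
  -- First-phase messages are control messages, so discarding them removes no information message.
  · have hinfo : ∀ v w s, (∃ m, sent v w s = some (true, m)) ↔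
        ∃ m, secondPhase (sent v w s) = some (true, m) := by
      intro v w s
      constructor
      · rintro ⟨m | m, hm⟩
        · have := (hrun.eq_of_inl hΔ hm).2.2.1
          simp at this
        · exact ⟨m, by rw [hm]; rfl⟩
      · rintro ⟨m, hm⟩
        rcases hs : sent v w s with _ | ⟨c, m' | m'⟩
        · rw [hs] at hm
          simp [secondPhase] at hm
        · rw [hs] at hm
          simp [secondPhase] at hm
        · rw [hs] at hm
          simp only [secondPhase, Option.bind_some, Sum.elim_inr, Option.some_inj,
            Prod.mk.injEq] at hm
          exact ⟨Sum.inr m', by rw [hm.1]⟩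
    simp only [behaviour, Behaviour.mk.injEq]
    constructor
    · funext v w s
      exact propext (hinfo v w s)
    · funext v s
      by_cases hv : v ∈ G.nodes
      · rcases lt_or_ge s (tick Δ G.ζ (t₀ + Δ) G.nodes.card) with h1 | h1
        · rw [if_neg fun h : _ ∧ _ => absurd h.1 (not_le.2 h1)]
          split_ifs
          · simp only [collectThen]
            rw [dif_neg (hrun.not_ready_of_lt ht₀ hG hv h1)]
          · rfl
        · obtain ⟨hr, hf⟩ := hrun.find_ready ht₀ hG hv h1
          rw [if_pos ⟨hle.trans h1, hv⟩, if_pos ⟨h1, hv⟩]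
          simp only [collectThen]
          rw [dif_pos hr, hf, hrun.subview_eq ht₀ hG hv h1]
      · rw [if_neg fun h => hv h.2, if_neg fun h => hv h.2]
  · intro T hfin
    refine (hfin.union (G.finite_firesAt hΔ (t₀ + Δ) T)).subset ?_
    rintro ⟨v, w, s⟩ ⟨hT, hs⟩
    rcases hs' : sent v w s with _ | ⟨c, m | m⟩
    · exact absurd hs' hs
    · exact Or.inr ⟨(hrun.eq_of_inl hΔ hs').2.2.2.2, hT⟩
    · refine Or.inl ⟨hT, ?_⟩
      simp only [hs', secondPhase]
      simp

end CollectRun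

/-! ### Comparison of the contexts -/

/-- The start date `t₁` of `A` is kept apart from the date `t'` at which the problem is posed. So
the reduction serves both notions of solvability: `t'` may follow the collection or be the original
date `t`. -/
theorem SolvesIn.collectThen {Q : Problem} {K₂ : Type}
    {κ : ℝ → ℝ → ℝ → ℝ → Set (Obs Q.Input) → K₂} {A : Algorithm K₂ Q.Input Q.Output}
    {delay : ℝ → ℝ → Prop} {G : TVG} {Δ : ℝ} (hG : G.BoundedRecurrent Δ)
    (h : ∀ inp, Q.Admissible G inp → ∀ t t₁, 0 ≤ t → t ≤ t₁ → ∀ sent,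
      IsRun A G (κ Δ G.ζ t t₁ (G.obs inp t Δ '' G.nodes)) inp t₁ sent →
      (∀ T : ℝ, {x : ℕ × ℕ × ℝ | x.2.2 ≤ T ∧ sent x.1 x.2.1 x.2.2 ≠ none}.Finite) ∧
      ∃ t', delay t t' ∧
        (behaviour A G (κ Δ G.ζ t t₁ (G.obs inp t Δ '' G.nodes)) inp t₁ sent).SilentBefore t' ∧
        Q.Correct G inp t'
          (behaviour A G (κ Δ G.ζ t t₁ (G.obs inp t Δ '' G.nodes)) inp t₁ sent)) :
    SolvesIn delay Q (DynNet.collectThen κ A) G Δ := by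
  intro inp hinp t ht sent hrun
  obtain ⟨t₁, sent₁, h1, h2, h3, h4⟩ := IsRun.collectThen_behaviour hrun ht hG
  obtain ⟨h5, t', h6, h7, h8⟩ := h inp hinp t t₁ ht h1 sent₁ h2
  rw [← h3] at h7 h8
  exact ⟨fun T => h4 T (h5 T), t', h6, h7, h8⟩

theorem ncard_image_obs {Input : Type} (G : TVG) (inp : ℕ → Input) (t Δ : ℝ) :
    (G.obs inp t Δ '' G.nodes).ncard = G.nodes.card := by
  rw [Set.ncard_image_of_injective _ (G.obs_injective inp t Δ), Set.ncard_coe_finset]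

theorem solvable_contextRn_subset : Solvable contextRn ⊆ Solvable contextBΔ := by
  rintro Q ⟨A, hA⟩
  refine ⟨collectThen (K₂ := contextRn.K) (fun _ _ _ _ F => (F.ncard : ℕ)) A, fun G Δ hG =>
    SolvesIn.collectThen hG fun inp hinp t t₁ ht h1 sent h2 => ?_⟩
  obtain ⟨h5, t', h6, h7⟩ :=
    hA G _ ⟨hG.1, ncard_image_obs G inp t Δ⟩ inp hinp t₁ (ht.trans h1) sent h2
  exact ⟨h5, t', h1.trans h6, h7⟩

theorem solvable_contextBΔ_subset : Solvable contextBΔ ⊆ Solvable contextPp := by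
  rintro Q ⟨A, hA⟩
  exact ⟨A, fun G p hG => hA G p (TVG.Periodic.boundedRecurrent hG)⟩

theorem solvableAtOnce_subset (C : Context) : SolvableAtOnce C ⊆ Solvable C := by
  rintro Q ⟨A, hA⟩
  refine ⟨A, fun G k hG inp hinp t ht sent hrun => ?_⟩
  obtain ⟨h1, t', h2, h3⟩ := hA G k hG inp hinp t ht sent hrun
  exact ⟨h1, t', h2.ge, h3⟩

theorem IsRun.silentBefore {K Input Output : Type} {A : Algorithm K Input Output} {G : TVG} {k : K}
    {inp : ℕ → Input} {t₁ : ℝ} {sent : ℕ → ℕ → ℝ → Option (Bool × A.Msg)}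
    (hrun : IsRun A G k inp t₁ sent) {t : ℝ} (ht : t ≤ t₁) :
    (behaviour A G k inp t₁ sent).SilentBefore t := by
  intro s hs v
  refine ⟨if_neg fun h => ?_, ?_⟩
  · linarith [h.1]
  · rintro w ⟨m, hm⟩
    rw [hrun v w s, if_neg fun h => by linarith [h.1]] at hm
    simp at hm

/-! ### Shortest broadcast in bounded-recurrent graphs -/

/-- The distance of a node from the emitter, according to a set of observations. -/
noncomputable def level (F : Set (Obs Bool)) (v : ℕ) : ℕ :=
  sInf {k | ∃ o ∈ F, o.2.1 = true ∧
    v ∈ ball (fun u w => ∃ o ∈ F, o.1 = u ∧ (o.2.2 w).Nonempty) o.1 k}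

/-- Every footprint edge is present at some date of `[t₀, t₀ + Δ]`, so the relation read off the
observations is the footprint itself. -/
theorem level_obs {G : TVG} {Δ t₀ : ℝ} (hG : G.BoundedRecurrent Δ) (ht₀ : 0 ≤ t₀) {inp : ℕ → Bool}
    {x : ℕ} (hx : x ∈ G.nodes) (hinp : ∀ v ∈ G.nodes, inp v = true ↔ v = x) (v : ℕ) :
    level (G.obs inp t₀ Δ '' G.nodes) v = sInf {k | v ∈ ball G.IsEdge x k} := by
  have hrel : (fun u w => ∃ o ∈ G.obs inp t₀ Δ '' G.nodes, o.1 = u ∧ (o.2.2 w).Nonempty) =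
      G.IsEdge := by
    funext u w
    refine propext ⟨?_, fun h => ?_⟩
    · rintro ⟨_, ⟨u', -, rfl⟩, rfl, s, hs, -⟩
      exact ⟨s, hs⟩
    · obtain ⟨s, h1, h2, h3, -⟩ := hG.exists_crossing h ht₀
      exact ⟨_, ⟨u, h.mem_nodes.1, rfl⟩, rfl, s, h3 ⟨le_rfl, by linarith [G.ζ_pos]⟩, h1, h2⟩
  unfold level
  rw [hrel]
  congr 1
  ext k
  constructor
  · rintro ⟨_, ⟨u, hu, rfl⟩, h1, h2⟩
    rwa [(hinp u hu).1 h1] at h2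
  · exact fun h => ⟨_, ⟨x, hx, rfl⟩, (hinp x hx).2 rfl, h⟩

open Classical in
/-- Each node sends the information at the ticks and appearances from the tick on whose number is
the distance of the node. The knowledge consists of the bound on the recurrence time, the distances
and the number of nodes. -/
noncomputable def levelBroadcast : Algorithm (ℝ × (ℕ → ℕ) × ℕ) Bool Unit where
  Msg := Unit
  send V w :=
    if V.Fires V.knowledge.1 V.start w ∧
      tick V.knowledge.1 V.ζ V.start (V.knowledge.2.1 V.id) ≤ V.now then some (true, ()) else none
  output V :=
    if tick V.knowledge.1 V.ζ V.start V.knowledge.2.2 ≤ V.now then some () else none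

/-- Induction on the distance. A node at distance `d + 1` is reached by tick `d + 1` from some node
at distance `d`. Any sender active before that tick has level at most `d`, and a neighbour cannot
have a smaller one; so the first reception comes from level `d`, which was informed by tick `d`. -/
theorem exists_shortest_infoJourney {G : TVG} {Δ t₀ t₁ : ℝ} (hG : G.BoundedRecurrent Δ)
    (ht₀ : 0 ≤ t₀) (ht₁ : t₀ ≤ t₁) {x : ℕ} (hx : x ∈ G.nodes) {lev : ℕ → ℕ}
    (hlev : ∀ v, lev v = sInf {k | v ∈ ball G.IsEdge x k}) {β : Behaviour Unit}
    (hβ : ∀ v w s, β.info v w s ↔ G.FiresAt Δ t₁ v w s ∧ tick Δ G.ζ t₁ (lev v) ≤ s) (d : ℕ) :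
    ∀ v ∈ G.nodes, lev v = d → ∃ J, InfoJourney G β t₀ x J v ∧ J.length = d ∧
      arrival G.ζ t₀ J ≤ tick Δ G.ζ t₁ d ∧
      ∀ J', InfoJourney G β t₀ x J' v → arrival G.ζ t₀ J ≤ arrival G.ζ t₀ J' := by
  have hmem : ∀ v ∈ G.nodes, v ∈ ball G.IsEdge x (lev v) := by
    intro v hv
    rw [hlev]
    exact Nat.sInf_mem (s := {k | v ∈ ball G.IsEdge x k})
      ⟨_, TVG.nodes_subset_ball hG.1.1 hx hv⟩
  have hle : ∀ v k, v ∈ ball G.IsEdge x k → lev v ≤ k := by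
    intro v k h
    rw [hlev]
    exact Nat.sInf_le h
  have hstep : ∀ u v, G.IsEdge u v → lev v ≤ lev u + 1 := fun u v h =>
    hle v _ (mem_ball_succ_of_rel (hmem u h.mem_nodes.1) h)
  induction d with
  | zero =>
    intro v hv hd
    have h1 := hmem v hv
    rw [hd] at h1
    obtain rfl : v = x := h1
    refine ⟨[], rfl, rfl, ?_, fun J' hJ' => ?_⟩
    · simpa [arrival, tick_zero] using ht₁
    · exact hJ'.le_arrival G.ζ_pos
  | succ d ih =>
    intro v hv hd
    have h1 := hmem v hv
    rw [hd] at h1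
    have hmono := tick_strictMono hG.2.1 G.ζ_pos t₁
    obtain ⟨w, hw, he⟩ : ∃ w ∈ ball G.IsEdge x d, G.IsEdge w v := by
      rcases h1 with h1 | h1
      · exact absurd (hle v d h1) (by omega)
      · exact h1
    have hwd : lev w = d := by
      have := hle w d hw
      have := hstep w v he
      omega
    obtain ⟨s, h2, h3, h4, h5⟩ := hG.exists_firesAt (ht₀.trans ht₁) he d
    -- The crossings into `v` up to date `s` are finitely many, and one exists, from `w`; so there
    -- is an earliest, and its sender is the predecessor used in the journey.
    have hfin : {y : ℕ × ℕ × ℝ | (G.FiresAt Δ t₁ y.1 y.2.1 y.2.2 ∧ y.2.2 ≤ s) ∧ y.2.1 = v ∧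
        β.info y.1 y.2.1 y.2.2 ∧ G.Crossable ⟨y.1, y.2.1, y.2.2⟩}.Finite :=
      (G.finite_firesAt hG.2.1 t₁ s).subset fun y hy => hy.1
    obtain ⟨⟨u, v', r⟩, ⟨⟨-, hrs⟩, hv', hinf, hcr⟩, hmin⟩ :=
      Set.exists_min_image _ (fun y => y.2.2) hfin
        ⟨(w, v, s), ⟨h5, le_rfl⟩, rfl, (hβ _ _ _).2 ⟨h5, by rwa [hwd]⟩, h4⟩
    dsimp only at hrs hv' hinf hcr hmin
    obtain rfl : v' = v := hv'
    have hue : G.IsEdge u v' := hcr.isEdge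
    have hud : lev u = d := by
      have h6 := hstep u v' hue
      have h7 : lev u < d + 1 := hmono.lt_iff_lt.1
        (lt_of_le_of_lt (((hβ _ _ _).1 hinf).2.trans hrs) (by linarith [G.ζ_pos]))
      omega
    obtain ⟨J, hJ1, hJ2, hJ3, -⟩ := ih u hue.mem_nodes.1 hud
    have hur := ((hβ _ _ _).1 hinf).2
    rw [hud] at hur
    refine ⟨J ++ [Hop.mk u v' r], ?_, by simp [hJ2], ?_, fun J' hJ' => ?_⟩
    · exact (isJourney_append_singleton (h := ⟨u, v', r⟩)).2 ⟨hJ1, hJ3.trans hur, ⟨hinf, hcr⟩, rfl⟩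
    · rw [arrival_append_singleton]
      dsimp only
      linarith
    · have hxv : x ≠ v' := by
        rintro rfl
        have := hle x 0 rfl
        omega
      obtain ⟨J'', h, rfl, -, -, ⟨h6, h7⟩, h8⟩ := IsJourney.exists_last hJ' hxv
      rw [arrival_append_singleton, arrival_append_singleton]
      have h9 : r ≤ h.date := by
        by_contra! hlt
        have := hmin (h.src, h.dst, h.date) ⟨⟨((hβ _ _ _).1 h6).1, by linarith⟩, h8, h6, h7⟩
        dsimp only at this
        linarith
      dsimp only
      linarith

/-- Starting only at `t₁` costs no hop, since footprint distance bounds every journey departing at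
`t` or later. At tick `n` the emitter may stop: all distances are below `n`. -/
theorem levelBroadcast_solves {G : TVG} {Δ t t₁ : ℝ} (hG : G.BoundedRecurrent Δ) (ht : 0 ≤ t)
    (h1 : t ≤ t₁) {inp : ℕ → Bool} {x : ℕ} (hx : x ∈ G.nodes)
    (hinp : ∀ v ∈ G.nodes, inp v = true ↔ v = x) {lev : ℕ → ℕ}
    (hlev : ∀ v, lev v = sInf {k | v ∈ ball G.IsEdge x k}) {n : ℕ} (hn : n = G.nodes.card)
    {sent₁ : ℕ → ℕ → ℝ → Option (Bool × levelBroadcast.Msg)}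
    (h2 : IsRun levelBroadcast G (Δ, lev, n) inp t₁ sent₁) :
    (∀ T : ℝ, {x : ℕ × ℕ × ℝ | x.2.2 ≤ T ∧ sent₁ x.1 x.2.1 x.2.2 ≠ none}.Finite) ∧
      ∃ t', t' = t ∧
        (behaviour levelBroadcast G (Δ, lev, n) inp t₁ sent₁).SilentBefore t' ∧
        TDBshortest.Correct G inp t'
          (behaviour levelBroadcast G (Δ, lev, n) inp t₁ sent₁) := by
  subst hn
  have hsent : ∀ v w s, sent₁ v w s ≠ none →
      G.FiresAt Δ t₁ v w s ∧ tick Δ G.ζ t₁ (lev v) ≤ s := by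
    intro v w s h
    rw [h2 v w s] at h
    split_ifs at h with h5
    · simp only [levelBroadcast] at h
      split_ifs at h with h6
      · exact ⟨(fires_viewAt le_rfl).1 h6.1, h6.2⟩
      · exact absurd rfl h
    · exact absurd rfl h
  refine ⟨fun T => (G.finite_firesAt hG.2.1 t₁ T).subset
    fun y hy => ⟨(hsent _ _ _ hy.2).1, hy.1⟩, t, rfl, h2.silentBefore h1, ?_⟩
  set β := behaviour levelBroadcast G (Δ, lev, G.nodes.card) inp t₁ sent₁ with hβdef
  have hβ : ∀ v w s, β.info v w s ↔ G.FiresAt Δ t₁ v w s ∧ tick Δ G.ζ t₁ (lev v) ≤ s := by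
    intro v w s
    constructor
    · rintro ⟨m, hm⟩
      exact hsent v w s (by simp [hm])
    · rintro ⟨h5, h6⟩
      refine ⟨(), ?_⟩
      rw [h2 v w s, if_pos ⟨h5.2.1, h5.1⟩]
      exact if_pos ⟨(fires_viewAt le_rfl).2 h5, h6⟩
  have hout : ∀ v ∈ G.nodes, ∀ T, β.out v T = some () ↔
      t₁ ≤ T ∧ tick Δ G.ζ t₁ G.nodes.card ≤ T := by
    intro v hv T
    simp only [hβdef, behaviour, levelBroadcast, viewAt]
    split_ifs with h5 h6 <;> simp_all
  have hkey := exists_shortest_infoJourney hG ht h1 hx hlev hβ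
  intro y hy hyx
  obtain rfl := (hinp y hy).1 hyx
  have hmono := tick_strictMono hG.2.1 G.ζ_pos t₁
  refine ⟨⟨tick Δ G.ζ t₁ G.nodes.card, (hout y hy _).2 ⟨le_tick hG.2.1 G.ζ_pos _ _, le_rfl⟩⟩,
    ?_, ?_, ?_⟩
  · intro T T' hT h
    have := (hout y hy T).1 h
    exact (hout y hy T').2 ⟨this.1.trans hT, this.2.trans hT⟩
  · intro T hT v hv
    obtain ⟨J, hJ1, -, hJ3, -⟩ := hkey _ v hv rfl
    refine ⟨J, hJ1, hJ3.trans (le_trans (hmono.monotone ?_) ((hout y hy T).1 hT).2)⟩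
    rw [hlev]
    exact Nat.sInf_le (m := G.nodes.card) (s := {k | v ∈ ball G.IsEdge y k})
      (ball_mono _ _ (Nat.sub_le _ _) (TVG.nodes_subset_ball hG.1.1 hx hv))
  · intro v hv
    obtain ⟨J, hJ1, hJ2, -, hJ4⟩ := hkey _ v hv rfl
    refine ⟨J, hJ1, hJ4, fun J' hJ' => ?_⟩
    rw [hJ2, hlev]
    exact Nat.sInf_le (IsJourney.mem_ball (fun h hc => TVG.Crossable.isEdge hc) hJ')

theorem TDBshortest_mem_solvableAtOnce : TDBshortest ∈ SolvableAtOnce contextBΔ := by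
  refine ⟨collectThen (fun Δ _ _ _ F => (Δ, level F, F.ncard)) levelBroadcast, fun G Δ hG =>
    SolvesIn.collectThen (Q := TDBshortest) (A := levelBroadcast) hG ?_⟩
  rintro inp ⟨x, hx, hinp⟩ t t₁ ht h1 sent h2
  exact levelBroadcast_solves hG ht h1 hx hinp (level_obs hG ht hx hinp)
    (ncard_image_obs (Input := Bool) G inp t Δ) h2

/-! ### Fastest broadcast in periodic graphs -/

open Classical in
/-- Send the information at the hops of a given set; terminate at a given date. -/
noncomputable def followPlan : Algorithm (ℝ × Set Hop) Bool Unit where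
  Msg := Unit
  send V w := if Hop.mk V.id w V.now ∈ V.knowledge.2 then some (true, ()) else none
  output V := if V.knowledge.1 ≤ V.now then some () else none

/-- The hops of `P.2` allow a broadcast from `x` that starts at date `t₁` or later and is over at
date `P.1`, the duration of which is minimum among the broadcasts that start at date `t₀` or
later, if there is a minimum. -/
def FastPlan (G : TVG) (x : ℕ) (t₀ t₁ : ℝ) (P : ℝ × Set Hop) : Prop :=
  P.2.Finite ∧ ∃ a, t₁ ≤ a ∧ (∀ h ∈ P.2, a ≤ h.date) ∧
    (∀ v ∈ G.nodes, ∃ J, IsJourney G.ζ (fun h => h ∈ P.2 ∧ G.Crossable h) a x J v ∧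
      arrival G.ζ a J ≤ P.1) ∧
    ∀ a₀ b₀, FastestWindow G x t₀ a₀ b₀ → P.1 - a ≤ b₀ - a₀

namespace TVG

variable {G : TVG} {p : ℝ}

theorem Periodic.crossable_shift (hG : G.Periodic p) {h : Hop} (h0 : 0 ≤ h.date)
    (hc : G.Crossable h) (k : ℕ) : G.Crossable ⟨h.src, h.dst, h.date + k * p⟩ := by
  intro s hs
  have h1 : s - k * p ∈ G.pres h.src h.dst := hc ⟨by linarith [hs.1], by linarith [hs.2]⟩
  simpa using (hG.2.2 _ _ hc.isEdge _ (by linarith [hs.1]) k).1 h1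

theorem Periodic.journey_shift (hG : G.Periodic p) {v : ℕ} (k : ℕ) {J : List Hop} :
    ∀ {a : ℝ} {u : ℕ}, 0 ≤ a → G.Journey a u J v →
      ∃ J', G.Journey (a + k * p) u J' v ∧
        arrival G.ζ (a + k * p) J' = arrival G.ζ a J + k * p := by
  induction J with
  | nil => exact fun _ h => ⟨[], h, by simp [arrival]⟩
  | cons h J ih =>
    rintro a u ha ⟨h1, h2, h3, h4⟩
    have h5 := G.ζ_pos
    obtain ⟨J', h6, h7⟩ := ih (by linarith) h4
    refine ⟨⟨h.src, h.dst, h.date + k * p⟩ :: J',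
      ⟨h1, by dsimp only; linarith, hG.crossable_shift (by linarith) h3 k, ?_⟩, ?_⟩
    · have h8 : h.date + k * p + G.ζ = h.date + G.ζ + k * p := by ring
      dsimp only
      rw [h8]
      exact h6
    · rw [arrival_cons, arrival_cons, ← h7]
      congr 1
      dsimp only
      ring

theorem Periodic.broadcastWindow_shift (hG : G.Periodic p) {x : ℕ} {a b : ℝ} (ha : 0 ≤ a)
    (h : BroadcastWindow G x a b) (k : ℕ) :
    BroadcastWindow G x (a + k * p) (b + k * p) := by
  intro v hv
  obtain ⟨J, hJ, hJb⟩ := h v hv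
  obtain ⟨J', hJ', h'⟩ := hG.journey_shift k ha hJ
  exact ⟨J', hJ', by linarith⟩

theorem BoundedRecurrent.exists_broadcastWindow {Δ : ℝ} (hG : G.BoundedRecurrent Δ) {x : ℕ}
    (hx : x ∈ G.nodes) {t : ℝ} (ht : 0 ≤ t) : ∃ b, BroadcastWindow G x t b := by
  have h : ∀ v : ℕ, ∃ J, v ∈ G.nodes → G.Journey t x J v := by
    intro v
    by_cases hv : v ∈ G.nodes
    · obtain ⟨J, hJ⟩ := hG.exists_journey ht (nodes_subset_ball hG.1.1 hx hv)
      exact ⟨J, fun _ => hJ⟩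
    · exact ⟨[], fun h => absurd h hv⟩
  choose J hJ using h
  obtain ⟨b, hb⟩ := (G.nodes.finite_toSet.image fun v => arrival G.ζ t (J v)).bddAbove
  exact ⟨b, fun v hv => ⟨J v, hJ v hv, hb ⟨v, hv, rfl⟩⟩⟩

end TVG

theorem BroadcastWindow.exists_fastPlan {G : TVG} {x : ℕ} {t₀ t₁ a b : ℝ} (ha : t₁ ≤ a)
    (h : BroadcastWindow G x a b)
    (hmin : ∀ a₀ b₀, FastestWindow G x t₀ a₀ b₀ → b - a ≤ b₀ - a₀) :
    ∃ P, FastPlan G x t₀ t₁ P := by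
  choose! J hJ hJb using h
  refine ⟨(b, ⋃ v ∈ G.nodes, {h | h ∈ J v}), ?_, a, ha, ?_, fun v hv => ⟨J v, ?_, hJb v hv⟩, hmin⟩
  · exact G.nodes.finite_toSet.biUnion fun v _ => (J v).finite_toSet
  · intro h hh
    simp only [Set.mem_iUnion] at hh
    obtain ⟨v, hv, hh⟩ := hh
    exact (hJ v hv).le_date G.ζ_pos h hh
  · refine IsJourney.imp G.ζ_pos (fun h hh _ hc => ⟨?_, hc⟩) (hJ v hv)
    simp only [Set.mem_iUnion]
    exact ⟨v, hv, hh⟩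

/-- A fastest window may begin before `t₁`, but delaying it by whole periods keeps its duration. If
no minimum exists, the requirement is void and any broadcast will do. -/
theorem TVG.Periodic.exists_fastPlan {G : TVG} {p : ℝ} (hG : G.Periodic p) {x : ℕ}
    (hx : x ∈ G.nodes) {t₀ t₁ : ℝ} (ht₀ : 0 ≤ t₀) (ht₁ : t₀ ≤ t₁) :
    ∃ P, FastPlan G x t₀ t₁ P := by
  by_cases hex : ∃ a b, FastestWindow G x t₀ a b
  · obtain ⟨a, b, h1, h2, h3⟩ := hex
    obtain ⟨k, hk⟩ := exists_nat_gt ((t₁ - a) / p)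
    rw [div_lt_iff₀ hG.2.1] at hk
    refine (hG.broadcastWindow_shift (ht₀.trans h1) h2 k).exists_fastPlan (by linarith)
      fun a₀ b₀ h => ?_
    have := h3 a₀ b₀ h.1 h.2.1
    linarith
  · obtain ⟨b, hb⟩ := hG.boundedRecurrent.exists_broadcastWindow hx (ht₀.trans ht₁)
    exact hb.exists_fastPlan le_rfl fun a₀ b₀ h => absurd ⟨a₀, b₀, h⟩ hex

/-- Two graphs that agree from date `t₀` on have the same plans. -/
theorem FastPlan.congr {G G' : TVG} {x : ℕ} {t₀ t₁ : ℝ} (hnodes : G.nodes = G'.nodes)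
    (hζ : G.ζ = G'.ζ) (hpres : ∀ u v s, t₀ ≤ s → (s ∈ G.pres u v ↔ s ∈ G'.pres u v))
    (ht₁ : t₀ ≤ t₁) {P : ℝ × Set Hop} (h : FastPlan G x t₀ t₁ P) : FastPlan G' x t₀ t₁ P := by
  have hcross : ∀ h : Hop, t₀ ≤ h.date → (G.Crossable h ↔ G'.Crossable h) := by
    intro h hh
    constructor
    · intro hc s hs
      exact (hpres _ _ _ (hh.trans hs.1)).1 (hc (by rwa [hζ]))
    · intro hc s hs
      exact (hpres _ _ _ (hh.trans hs.1)).2 (hc (by rwa [← hζ]))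
  have hwin : ∀ a b, t₀ ≤ a → (BroadcastWindow G x a b ↔ BroadcastWindow G' x a b) := by
    intro a b hab
    unfold BroadcastWindow TVG.Journey
    rw [hnodes, hζ]
    refine forall₂_congr fun v _ => exists_congr fun J => and_congr_left fun _ => ⟨?_, ?_⟩
    · exact IsJourney.imp G'.ζ_pos fun h _ hh => (hcross h (hab.trans hh)).1
    · exact IsJourney.imp G'.ζ_pos fun h _ hh => (hcross h (hab.trans hh)).2
  obtain ⟨h1, a, h2, h3, h4, h5⟩ := h
  refine ⟨h1, a, h2, h3, ?_, ?_⟩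
  · rw [← hnodes, ← hζ]
    intro v hv
    obtain ⟨J, hJ, hJb⟩ := h4 v hv
    exact ⟨J, hJ.imp G.ζ_pos fun h _ hh hc =>
      ⟨hc.1, (hcross h (ht₁.trans (h2.trans hh))).1 hc.2⟩, hJb⟩
  · rintro a₀ b₀ ⟨h6, h7, h8⟩
    exact h5 a₀ b₀ ⟨h6, (hwin a₀ b₀ h6).2 h7,
      fun a' b' h9 h10 => h8 a' b' h9 ((hwin a' b' h9).1 h10)⟩

/-- A fastest plan, determined by the observations of the nodes. -/
noncomputable def chosenPlan (p ζ t₀ t₁ : ℝ) (F : Set (Obs Bool)) : ℝ × Set Hop :=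
  Classical.epsilon fun P => ∃ (G : TVG) (inp : ℕ → Bool) (x : ℕ), G.Periodic p ∧ G.ζ = ζ ∧
    F = G.obs inp t₀ p '' G.nodes ∧ x ∈ G.nodes ∧ inp x = true ∧ FastPlan G x t₀ t₁ P

/-- The plan is chosen for some graph `G'` with the same observations, perhaps not the actual one.
Observations over one period fix nodes, emitter and, by periodicity, all presence from `t₀` on;
hence a plan for `G'` is one for `G`. -/
theorem fastPlan_chosenPlan {G : TVG} {p : ℝ} (hG : G.Periodic p) {inp : ℕ → Bool} {x : ℕ}
    (hx : x ∈ G.nodes) (hinp : ∀ v ∈ G.nodes, inp v = true ↔ v = x) {t₀ t₁ : ℝ} (ht₀ : 0 ≤ t₀)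
    (ht₁ : t₀ ≤ t₁) :
    FastPlan G x t₀ t₁ (chosenPlan p G.ζ t₀ t₁ (G.obs inp t₀ p '' G.nodes)) := by
  obtain ⟨P, hP⟩ := hG.exists_fastPlan hx ht₀ ht₁
  obtain ⟨G', inp', x', hG', hζ, hF, hx', hinp', hplan⟩ :=
    Classical.epsilon_spec (p := fun P => ∃ (G' : TVG) (inp' : ℕ → Bool) (x : ℕ),
      G'.Periodic p ∧ G'.ζ = G.ζ ∧ G.obs inp t₀ p '' G.nodes = G'.obs inp' t₀ p '' G'.nodes ∧
      x ∈ G'.nodes ∧ inp' x = true ∧ FastPlan G' x t₀ t₁ P)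
      ⟨P, G, inp, x, hG, rfl, rfl, hx, (hinp x hx).2 rfl, hP⟩
  have hobs : ∀ v ∈ G'.nodes, v ∈ G.nodes ∧ G.obs inp t₀ p v = G'.obs inp' t₀ p v := by
    intro v hv
    have h1 : G'.obs inp' t₀ p v ∈ G.obs inp t₀ p '' G.nodes := hF ▸ ⟨v, hv, rfl⟩
    obtain ⟨u, hu, h2⟩ := h1
    obtain rfl : u = v := congrArg Prod.fst h2
    exact ⟨hu, h2⟩
  have hnodes : G'.nodes = G.nodes := by
    refine Finset.Subset.antisymm (fun v hv => (hobs v hv).1) fun v hv => ?_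
    have h1 : G.obs inp t₀ p v ∈ G'.obs inp' t₀ p '' G'.nodes := hF ▸ ⟨v, hv, rfl⟩
    obtain ⟨u, hu, h2⟩ := h1
    obtain rfl : u = v := congrArg Prod.fst h2
    exact hu
  have hseen : ∀ u ∈ G'.nodes, ∀ v, G.pres u v ∩ Set.Icc t₀ (t₀ + p) =
      G'.pres u v ∩ Set.Icc t₀ (t₀ + p) := fun u hu v =>
    congrFun (congrArg (fun o => o.2.2) (hobs u hu).2) v
  have hedge : ∀ u ∈ G'.nodes, ∀ v, G'.IsEdge u v ↔ G.IsEdge u v := by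
    intro u hu v
    constructor
    · intro he
      obtain ⟨s, h1, h2, h3, -⟩ := hG'.boundedRecurrent.exists_crossing he ht₀
      have h4 : s ∈ G'.pres u v ∩ Set.Icc t₀ (t₀ + p) :=
        ⟨h3 ⟨le_rfl, by linarith [G'.ζ_pos]⟩, h1, h2⟩
      rw [← hseen u hu v] at h4
      exact ⟨s, h4.1⟩
    · intro he
      obtain ⟨s, h1, h2, h3, -⟩ := hG.boundedRecurrent.exists_crossing he ht₀
      have h4 : s ∈ G.pres u v ∩ Set.Icc t₀ (t₀ + p) :=
        ⟨h3 ⟨le_rfl, by linarith [G.ζ_pos]⟩, h1, h2⟩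
      rw [hseen u hu v] at h4
      exact ⟨s, h4.1⟩
  have hpres : ∀ u v s, t₀ ≤ s → (s ∈ G'.pres u v ↔ s ∈ G.pres u v) := by
    intro u v s hs
    by_cases hu : u ∈ G'.nodes
    · by_cases he : G'.IsEdge u v
      · have h0 : 0 ≤ (s - t₀) / p := div_nonneg (by linarith) hG.2.1.le
        have h1 := Nat.floor_le h0
        have h2 := Nat.lt_floor_add_one ((s - t₀) / p)
        rw [le_div_iff₀ hG.2.1] at h1
        rw [div_lt_iff₀ hG.2.1, add_mul] at h2
        -- Going back `k` periods brings `s` into the observed window.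
        set k := ⌊(s - t₀) / p⌋₊
        have h3 := hG'.2.2 u v he (s - k * p) (by linarith) k
        have h4 := hG.2.2 u v ((hedge u hu v).1 he) (s - k * p) (by linarith) k
        rw [sub_add_cancel] at h3 h4
        rw [← h3, ← h4]
        have h5 : s - k * p ∈ Set.Icc t₀ (t₀ + p) := ⟨by linarith, by linarith⟩
        have h6 := Set.ext_iff.1 (hseen u hu v) (s - k * p)
        simp only [Set.mem_inter_iff, h5, and_true] at h6
        exact h6.symm
      · exact ⟨fun h => absurd ⟨s, h⟩ he, fun h => absurd ((hedge u hu v).2 ⟨s, h⟩) he⟩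
    · refine ⟨fun h => absurd (G'.pres_nodes u v ⟨s, h⟩).1 hu, fun h => ?_⟩
      rw [hnodes] at hu
      exact absurd (G.pres_nodes u v ⟨s, h⟩).1 hu
  obtain rfl : x' = x := by
    obtain ⟨h1, h2⟩ := hobs x' hx'
    refine (hinp x' h1).1 ?_
    rw [← hinp']
    exact congrArg (fun o => o.2.1) h2
  exact FastPlan.congr hnodes hζ hpres ht₁ hplan

theorem followPlan_solves {G : TVG} {x : ℕ} {t t₁ : ℝ}
    (h1 : t ≤ t₁) {inp : ℕ → Bool}
    (hinp : ∀ v ∈ G.nodes, inp v = true ↔ v = x) {P : ℝ × Set Hop} (hP : FastPlan G x t t₁ P)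
    {sent₁ : ℕ → ℕ → ℝ → Option (Bool × followPlan.Msg)}
    (h2 : IsRun followPlan G P inp t₁ sent₁) :
    (∀ T : ℝ, {x : ℕ × ℕ × ℝ | x.2.2 ≤ T ∧ sent₁ x.1 x.2.1 x.2.2 ≠ none}.Finite) ∧
      ∃ t', t' = t ∧ (behaviour followPlan G P inp t₁ sent₁).SilentBefore t' ∧
        TDBfastest.Correct G inp t' (behaviour followPlan G P inp t₁ sent₁) := by
  obtain ⟨hfin, a, ha, hdate, hJ, hmin⟩ := hP
  have hsent : ∀ v w s, sent₁ v w s ≠ none → Hop.mk v w s ∈ P.2 := by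
    intro v w s h
    rw [h2 v w s] at h
    split_ifs at h with h5
    · simp only [followPlan] at h
      split_ifs at h with h6
      · exact h6
      · exact absurd rfl h
    · exact absurd rfl h
  refine ⟨fun T => Set.Finite.of_finite_image (f := fun y => Hop.mk y.1 y.2.1 y.2.2)
    (hfin.subset ?_) ?_, t, rfl, h2.silentBefore h1, ?_⟩
  · rintro _ ⟨y, hy, rfl⟩
    exact hsent _ _ _ hy.2
  · rintro ⟨u, v, s⟩ - ⟨u', v', s'⟩ - h
    simpa using h
  set β := behaviour followPlan G P inp t₁ sent₁ with hβdef
  have hβ : ∀ h : Hop, h ∈ P.2 → G.Crossable h → β.info h.src h.dst h.date := by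
    intro h hh hc
    refine ⟨(), ?_⟩
    rw [h2, if_pos ⟨ha.trans (hdate h hh), hc ⟨le_rfl, by linarith [G.ζ_pos]⟩⟩]
    exact if_pos hh
  have hout : ∀ v ∈ G.nodes, ∀ T, β.out v T = some () ↔ t₁ ≤ T ∧ P.1 ≤ T := by
    intro v hv T
    simp only [hβdef, behaviour, followPlan, viewAt]
    split_ifs with h5 h6 <;> simp_all
  have hinfo : ∀ v ∈ G.nodes, ∃ J, InfoJourney G β a x J v ∧ arrival G.ζ a J ≤ P.1 := by
    intro v hv
    obtain ⟨J, h3, h4⟩ := hJ v hv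
    exact ⟨J, h3.imp G.ζ_pos fun h _ _ hh => ⟨hβ h hh.1 hh.2, hh.2⟩, h4⟩
  intro y hy hyx
  obtain rfl := (hinp y hy).1 hyx
  refine ⟨⟨max t₁ P.1, (hout y hy _).2 ⟨le_max_left _ _, le_max_right _ _⟩⟩, ?_, ?_, ?_⟩
  · intro T T' hT h
    have := (hout y hy T).1 h
    exact (hout y hy T').2 ⟨this.1.trans hT, this.2.trans hT⟩
  · intro T hT v hv
    obtain ⟨J, h3, h4⟩ := hinfo v hv
    have h5 : t ≤ a := h1.trans ha
    exact ⟨J, h3.mono_start h5,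
      (arrival_mono_start h5 J).trans (h4.trans ((hout y hy T).1 hT).2)⟩
  · refine ⟨a, P.1, h1.trans ha, ?_, hinfo, hmin⟩
    rintro w s ⟨m, hm⟩
    exact hdate _ (hsent y w s (by simp [hm]))

theorem TDBfastest_mem_solvableAtOnce : TDBfastest ∈ SolvableAtOnce contextPp := by
  refine ⟨collectThen chosenPlan followPlan, fun G p hG =>
    SolvesIn.collectThen (Q := TDBfastest) (A := followPlan)
      (TVG.Periodic.boundedRecurrent hG) ?_⟩
  rintro inp ⟨x, hx, hinp⟩ t t₁ ht h1 sent h2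
  exact followPlan_solves h1 hinp (fastPlan_chosenPlan hG hx hinp ht h1) h2

/-! ### Executions in graphs that agree up to some date -/

section Agree

variable {K Input Output : Type} {A : Algorithm K Input Output} {G G' : TVG} {k : K}
  {inp : ℕ → Input} {t₀ T : ℝ} {sent sent' : ℕ → ℕ → ℝ → Option (Bool × A.Msg)}

/-- Causality, by induction in steps of `ζ`: a decision at date `t` uses presence up to `t` and
messages sent by `t - ζ`. -/
theorem IsRun.eq_of_agree (hζ : G.ζ = G'.ζ)
    (hpres : ∀ u v, ∀ s ≤ T, (s ∈ G.pres u v ↔ s ∈ G'.pres u v))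
    (h : IsRun A G k inp t₀ sent) (h' : IsRun A G' k inp t₀ sent') (v w : ℕ) {t : ℝ} (ht : t ≤ T) :
    sent v w t = sent' v w t := by
  have key : ∀ N : ℕ, ∀ v w t, t ≤ T → t < t₀ + N * G.ζ → sent v w t = sent' v w t := by
    intro N
    induction N with
    | zero =>
      intro v w t _ hN
      simp only [Nat.cast_zero, zero_mul, add_zero] at hN
      rw [h v w t, h' v w t, if_neg fun h => by linarith [h.1], if_neg fun h => by linarith [h.1]]
    | succ N ih =>
      intro v w t ht hN
      push_cast at hN
      have hview : viewAt G k inp t₀ sent v t = viewAt G' k inp t₀ sent' v t := by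
        simp only [viewAt, View.mk.injEq, true_and]
        refine ⟨hζ, ?_, ?_⟩
        · funext u
          ext s
          simp only [Set.mem_inter_iff, Set.mem_Icc]
          exact ⟨fun hs => ⟨(hpres _ _ _ (hs.2.2.trans ht)).1 hs.1, hs.2⟩,
            fun hs => ⟨(hpres _ _ _ (hs.2.2.trans ht)).2 hs.1, hs.2⟩⟩
        · funext u s
          rw [← hζ]
          have hiff : (s ≤ t ∧ Set.Icc (s - G.ζ) s ⊆ G.pres u v) ↔
              (s ≤ t ∧ Set.Icc (s - G.ζ) s ⊆ G'.pres u v) := and_congr_right fun hs =>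
            ⟨fun hsub r hr => (hpres _ _ _ (hr.2.trans (hs.trans ht))).1 (hsub hr),
              fun hsub r hr => (hpres _ _ _ (hr.2.trans (hs.trans ht))).2 (hsub hr)⟩
          by_cases hs : s ≤ t ∧ Set.Icc (s - G.ζ) s ⊆ G.pres u v
          · rw [if_pos hs, if_pos (hiff.1 hs)]
            exact ih _ _ _ (by linarith [hs.1, G.ζ_pos]) (by linarith [hs.1])
          · rw [if_neg hs, if_neg fun h => hs (hiff.2 h)]
      rw [h v w t, h' v w t, hview]
      by_cases hc : t₀ ≤ t ∧ t ∈ G.pres v w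
      · rw [if_pos hc, if_pos ⟨hc.1, (hpres v w t ht).1 hc.2⟩]
      · rw [if_neg hc, if_neg fun h => hc ⟨h.1, (hpres v w t ht).2 h.2⟩]
  obtain ⟨N, hN⟩ := exists_nat_gt ((t - t₀) / G.ζ)
  rw [div_lt_iff₀ G.ζ_pos] at hN
  exact key N v w t ht (by linarith)

theorem IsJourney.date_add_le_arrival {ζ : ℝ} (hζ : 0 < ζ) {ok : Hop → Prop} {v : ℕ}
    {J : List Hop} : ∀ {t : ℝ} {u : ℕ}, IsJourney ζ ok t u J v →
      ∀ h ∈ J, h.date + ζ ≤ arrival ζ t J := by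
  induction J with
  | nil => simp
  | cons a l ih =>
    rintro t u ⟨-, -, -, h4⟩ h hh
    rw [arrival_cons]
    rcases List.mem_cons.1 hh with rfl | hh
    · exact h4.le_arrival hζ
    · exact ih h4 h hh

/-- A transmission of the information in `G` that is over at date `T` also takes place in `G'`. -/
theorem InfoJourney.of_agree (hpres : ∀ u v, ∀ s ≤ T, (s ∈ G.pres u v ↔ s ∈ G'.pres u v))
    (hζ : G.ζ = G'.ζ)
    (h : IsRun A G k inp t₀ sent) (h' : IsRun A G' k inp t₀ sent') {t : ℝ} {x v : ℕ} {J : List Hop}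
    (hJ : InfoJourney G (behaviour A G k inp t₀ sent) t x J v) (hT : arrival G.ζ t J ≤ T) :
    InfoJourney G' (behaviour A G' k inp t₀ sent') t x J v := by
  unfold InfoJourney at *
  rw [← hζ]
  refine IsJourney.imp G.ζ_pos (fun a ha _ hok => ?_) hJ
  have h1 := (hJ.date_add_le_arrival G.ζ_pos a ha).trans hT
  obtain ⟨⟨m, hm⟩, hc⟩ := hok
  refine ⟨⟨m, ?_⟩, fun s hs => ?_⟩
  · rw [← hm]
    exact (h.eq_of_agree hζ hpres h' _ _ (by linarith [G.ζ_pos])).symm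
  · rw [← hζ] at hs
    exact (hpres _ _ _ (hs.2.trans h1)).1 (hc hs)

end Agree

/-- What both impossibility proofs extract from a supposed algorithm. The date `t'` may differ from
graph to graph, even between graphs that agree for a long time. -/
theorem exists_TDB_run {C : Context} {crit : TVG → ℕ → ℝ → Behaviour Unit → Prop}
    {A : Algorithm C.K Bool Unit}
    (hA : ∀ G k, C.Holds G k → SolvesIn (fun t t' => t ≤ t') (TDB crit) A G k) {G : TVG} {k : C.K}
    (hG : C.Holds G k) {x : ℕ} (hx : x ∈ G.nodes) :
    ∃ sent t', IsRun A G k (fun v => decide (v = x)) 0 sent ∧ 0 ≤ t' ∧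
      (∀ v w s, (behaviour A G k (fun v => decide (v = x)) 0 sent).info v w s → t' ≤ s) ∧
      (∃ T, ∀ v ∈ G.nodes, ∃ J,
        InfoJourney G (behaviour A G k (fun v => decide (v = x)) 0 sent) t' x J v ∧
          arrival G.ζ t' J ≤ T) ∧
      crit G x t' (behaviour A G k (fun v => decide (v = x)) 0 sent) := by
  obtain ⟨sent, hrun, -⟩ := existsUnique_isRun A G k (fun v => decide (v = x)) 0
  obtain ⟨-, t', h1, h2, h3⟩ := hA G k hG (fun v => decide (v = x))
    ⟨x, hx, fun v _ => decide_eq_true_iff⟩ 0 le_rfl sent hrun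
  obtain ⟨⟨T, h4⟩, -, h5, h6⟩ := h3 x hx (decide_eq_true_iff.2 rfl)
  refine ⟨sent, t', hrun, h1, fun v w s hs => ?_, ⟨T, h5 T h4⟩, h6⟩
  by_contra! hlt
  exact (h2 s hlt v).2 w hs

/-! ### Graphs with three nodes -/

/-- The union of the intervals of length one that start in `S`. -/
def span (S : Set ℝ) : Set ℝ := {t | ∃ s ∈ S, s ≤ t ∧ t ≤ s + 1}

open scoped Pointwise in
theorem isClosed_span {S : Set ℝ} (hS : IsClosed S) : IsClosed (span S) := by
  have : span S = S + Set.Icc (0 : ℝ) 1 := by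
    ext t
    simp only [span, Set.mem_add, Set.mem_ofPred_eq]
    constructor
    · rintro ⟨s, hs, h1, h2⟩
      exact ⟨s, hs, t - s, ⟨by linarith, by linarith⟩, by ring⟩
    · rintro ⟨s, hs, r, hr, rfl⟩
      exact ⟨s, hs, by linarith [hr.1], by linarith [hr.2]⟩
  rw [this]
  exact hS.add_right_of_isCompact isCompact_Icc

theorem icc_subset_span {S : Set ℝ} {s : ℝ} (hs : s ∈ S) : Set.Icc s (s + 1) ⊆ span S :=
  fun _ ht => ⟨s, hs, ht.1, ht.2⟩

theorem subset_span {S : Set ℝ} : S ⊆ span S := fun s hs => ⟨s, hs, le_rfl, by linarith⟩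

/-- The starts of contacts: `A` between the nodes `0` and `1`, `B` between `1` and `2`, and `C`
between `0` and `2`. -/
def triStarts (A B C : Set ℝ) (u v : ℕ) : Set ℝ :=
  if (u = 0 ∧ v = 1) ∨ (u = 1 ∧ v = 0) then A
  else if (u = 1 ∧ v = 2) ∨ (u = 2 ∧ v = 1) then B
  else if (u = 0 ∧ v = 2) ∨ (u = 2 ∧ v = 0) then C else ∅

theorem triStarts_induction {p : Set ℝ → Prop} {A B C : Set ℝ} (hA : p A) (hB : p B) (hC : p C)
    (h0 : p ∅) (u v : ℕ) : p (triStarts A B C u v) := by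
  unfold triStarts
  split_ifs <;> assumption

/-- The graph with crossing delay `1` and nodes `0`, `1`, `2`, the contacts of which are unit
intervals with given starts. -/
def tri (A B C : Set ℝ) (hA : IsClosed A ∧ A ⊆ Set.Ici 0) (hB : IsClosed B ∧ B ⊆ Set.Ici 0)
    (hC : IsClosed C ∧ C ⊆ Set.Ici 0) : TVG where
  nodes := Finset.range 3
  ζ := 1
  ζ_pos := one_pos
  pres u v := span (triStarts A B C u v)
  pres_symm u v := by
    congr 1
    unfold triStarts
    grind
  pres_self u := by
    have : triStarts A B C u u = ∅ := by
      unfold triStarts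
      grind
    rw [this]
    simp [span]
  pres_nodes u v h := by
    obtain ⟨t, s, hs, -⟩ := h
    unfold triStarts at hs
    split_ifs at hs with h1 h2 h3
    · simp only [Finset.mem_range]
      omega
    · simp only [Finset.mem_range]
      omega
    · simp only [Finset.mem_range]
      omega
    · exact absurd hs (Set.notMem_empty s)
  pres_nonneg u v t ht := by
    obtain ⟨s, hs, h1, -⟩ := ht
    have : triStarts A B C u v ⊆ Set.Ici 0 :=
      triStarts_induction (p := fun S => S ⊆ Set.Ici 0) hA.2 hB.2 hC.2 (Set.empty_subset _) u v
    exact le_trans (this hs) h1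
  pres_closed u v := isClosed_span
    (triStarts_induction (p := IsClosed) hA.1 hB.1 hC.1 isClosed_empty u v)
  pres_length u v t ht := by
    obtain ⟨s, hs, h1⟩ := ht
    exact ⟨s, h1, icc_subset_span hs⟩

theorem isClosed_Ici_subset {a : ℝ} (ha : 0 ≤ a) :
    IsClosed (Set.Ici a) ∧ Set.Ici a ⊆ Set.Ici (0 : ℝ) :=
  ⟨isClosed_Ici, Set.Ici_subset_Ici.2 ha⟩

theorem isClosed_empty_subset : IsClosed (∅ : Set ℝ) ∧ (∅ : Set ℝ) ⊆ Set.Ici 0 :=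
  ⟨isClosed_empty, Set.empty_subset _⟩

section Tri

variable {A B C : Set ℝ} {hA : IsClosed A ∧ A ⊆ Set.Ici 0} {hB : IsClosed B ∧ B ⊆ Set.Ici 0}
  {hC : IsClosed C ∧ C ⊆ Set.Ici 0}

theorem tri_connected (hA0 : A.Nonempty) (hB0 : B.Nonempty) :
    (tri A B C hA hB hC).footprint.Connected := by
  have h1 : 1 ∈ (tri A B C hA hB hC).nodes := by simp [tri]
  have key : ∀ v : {v : ℕ // v ∈ (tri A B C hA hB hC).nodes},
      (tri A B C hA hB hC).footprint.Reachable ⟨1, h1⟩ v := by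
    rintro ⟨v, hv⟩
    have hv' : v < 3 := Finset.mem_range.1 hv
    interval_cases v
    · refine SimpleGraph.Adj.reachable ?_
      change (span (triStarts A B C 1 0)).Nonempty
      exact (by simpa [triStarts] using hA0 : (triStarts A B C 1 0).Nonempty).mono subset_span
    · exact SimpleGraph.Reachable.refl _
    · refine SimpleGraph.Adj.reachable ?_
      change (span (triStarts A B C 1 2)).Nonempty
      exact (by simpa [triStarts] using hB0 : (triStarts A B C 1 2).Nonempty).mono subset_span
  have : Nonempty {v : ℕ // v ∈ (tri A B C hA hB hC).nodes} := ⟨⟨1, h1⟩⟩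
  exact ⟨fun u v => (key u).symm.trans (key v)⟩

theorem tri_recurrent (hA0 : A.Nonempty) (hB0 : B.Nonempty)
    (h : ∀ u v, (triStarts A B C u v).Nonempty → ∀ t, ∃ s ∈ triStarts A B C u v, t < s) :
    (tri A B C hA hB hC).Recurrent := by
  refine ⟨tri_connected hA0 hB0, fun u v he t _ _ => ?_⟩
  obtain ⟨r, s, hs, -⟩ := he
  obtain ⟨s', h1, h2⟩ := h u v ⟨s, hs⟩ t
  exact ⟨s', h2, subset_span h1⟩

end Tri

/-! ### Shortest broadcast is impossible in recurrent graphs -/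

/-- On the path 0–1–2 with permanent edges, node 2 is informed by some `T`. Let the edge 0–2 be
present only from `M > T` on: `n = 3` still holds and node 2 is still informed by `T`, although a
later journey has a single hop. The first reception would have to use the edge 0–2 before it exists.
-/
theorem TDBshortest_notMem_solvable : TDBshortest ∉ Solvable contextRn := by
  rintro ⟨A, hA⟩
  have hrec : ∀ (C : Set ℝ) (hC : IsClosed C ∧ C ⊆ Set.Ici 0),
      (∀ s ∈ C, ∀ t, ∃ r ∈ C, t < r) →
      (tri (Set.Ici 0) (Set.Ici 0) C (isClosed_Ici_subset le_rfl) (isClosed_Ici_subset le_rfl)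
        hC).Recurrent := by
    intro C hC h
    refine tri_recurrent Set.nonempty_Ici Set.nonempty_Ici fun u v => ?_
    have hI : ∀ a : ℝ, (Set.Ici a).Nonempty → ∀ t, ∃ s ∈ Set.Ici a, t < s := fun a _ t =>
      ⟨max a (t + 1), Set.mem_Ici.2 (le_max_left _ _), lt_of_lt_of_le (by linarith) (le_max_right _ _)⟩
    refine triStarts_induction (p := fun S => S.Nonempty → ∀ t, ∃ s ∈ S, t < s) (hI 0) (hI 0) ?_ ?_
      u v
    · rintro ⟨s, hs⟩ t
      exact h s hs t
    · rintro ⟨s, hs⟩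
      exact absurd hs (Set.notMem_empty s)
  obtain ⟨sent, t', hrun, -, -, ⟨T, hT⟩, -⟩ := exists_TDB_run hA (k := (3 : ℕ))
    ⟨hrec ∅ isClosed_empty_subset (by simp), by simp [tri]⟩ (x := 0) (by simp [tri])
  obtain ⟨J, hJ, hJT⟩ := hT 2 (by simp [tri])
  have hM : 0 ≤ max T 0 + 1 := by linarith [le_max_right T 0]
  have hTM : T < max T 0 + 1 := by linarith [le_max_left T 0]
  set M := max T 0 + 1
  obtain ⟨sent', t'', hrun', -, hsil, -, hcrit⟩ := exists_TDB_run hA (k := (3 : ℕ))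
    ⟨hrec (Set.Ici M) (isClosed_Ici_subset hM) (fun _ _ t => ⟨max M (t + 1), Set.mem_Ici.2 (le_max_left _ _),
      lt_of_lt_of_le (by linarith) (le_max_right _ _)⟩), by simp [tri]⟩ (x := 0) (by simp [tri])
  have hpres : ∀ u v, ∀ s ≤ T,
      (s ∈ (tri (Set.Ici 0) (Set.Ici 0) ∅ (isClosed_Ici_subset le_rfl)
        (isClosed_Ici_subset le_rfl) isClosed_empty_subset).pres u v ↔
      s ∈ (tri (Set.Ici 0) (Set.Ici 0) (Set.Ici M) (isClosed_Ici_subset le_rfl)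
        (isClosed_Ici_subset le_rfl) (isClosed_Ici_subset hM)).pres u v) := by
    intro u v s hs
    simp only [tri, triStarts]
    split_ifs
    · rfl
    · rfl
    · simp only [span, Set.mem_ofPred_eq, Set.mem_empty_iff_false, false_and, exists_false,
        Set.mem_Ici, false_iff]
      rintro ⟨r, h1, h2, -⟩
      linarith
    · rfl
  have hJ' := InfoJourney.of_agree hpres rfl hrun hrun' hJ hJT
  obtain ⟨J₂, hJ₂, hmin, hlen⟩ := hcrit 2 (by simp [tri])
  have hle : arrival 1 t'' J₂ ≤ T := by
    cases J with
    | nil => exact absurd hJ' (by simp [InfoJourney, IsJourney])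
    | cons h J =>
      obtain ⟨h1, h2, h3, h4⟩ := hJ'
      -- The first hop carries information, hence is not earlier than `t''`; so a journey counted
      -- from `t'` also counts from `t''`.
      have h5 := hmin (h :: J) ⟨h1, hsil _ _ _ h3.1, h3, h4⟩
      rw [arrival_cons] at h5
      rw [arrival_cons] at hJT
      exact h5.trans hJT
  -- The competing one-hop journey may be as late as needed, so no bound on `t''` is required.
  have hD : ∃ D, t'' ≤ D ∧ M ≤ D := ⟨max t'' M, le_max_left _ _, le_max_right _ _⟩
  obtain ⟨D, hD1, hD2⟩ := hD
  have h1 := hlen [⟨0, 2, D⟩] ⟨rfl, hD1, icc_subset_span (by simpa [triStarts] using hD2), rfl⟩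
  match J₂, hJ₂, h1, hle with
  | [], hJ₂, _, _ => exact absurd hJ₂ (by simp [InfoJourney, IsJourney])
  | [h], ⟨h2, h3, ⟨h4, h5⟩, h6⟩, _, hle =>
    have h6' : h.dst = 2 := h6
    have h7 : h.date ∈ span (triStarts (Set.Ici 0) (Set.Ici 0) (Set.Ici M) h.src h.dst) :=
      h5 ⟨le_rfl, by simp [tri]⟩
    rw [h2, h6'] at h7
    obtain ⟨s, hs, h8, -⟩ := h7
    have hs' : M ≤ s := by simpa [triStarts] using hs
    rw [arrival_cons] at hle
    simp only [arrival, List.getLast?_nil] at hle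
    linarith
  | _ :: _ :: _, _, h1, _ => simp at h1

/-! ### Fastest broadcast is impossible in bounded-recurrent graphs -/

/-- The dates `4 k + c`, and those in `U`. -/
def fourStarts (c : ℝ) (U : Set ℝ) : Set ℝ := (Set.range fun k : ℕ => 4 * (k : ℝ) + c) ∪ U

theorem isClosed_fourStarts {c : ℝ} (hc : 0 ≤ c) {U : Set ℝ}
    (hU : U = ∅ ∨ ∃ K : ℕ, U = Set.Ici (4 * (K : ℝ))) :
    IsClosed (fourStarts c U) ∧ fourStarts c U ⊆ Set.Ici 0 := by
  have h1 : (Set.range fun k : ℕ => 4 * (k : ℝ) + c) =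
      (fun x : ℝ => (x - c) / 4) ⁻¹' Set.range ((↑) : ℕ → ℝ) := by
    ext x
    simp only [Set.mem_range, Set.mem_preimage]
    refine exists_congr fun k => ⟨fun h => ?_, fun h => ?_⟩
    · rw [← h]
      ring
    · rw [h]
      ring
  have h2 : IsClosed (Set.range fun k : ℕ => 4 * (k : ℝ) + c) := by
    rw [h1]
    exact Nat.isClosedEmbedding_coe_real.isClosed_range.preimage (by fun_prop)
  have h3 : IsClosed U ∧ U ⊆ Set.Ici 0 := by
    rcases hU with rfl | ⟨K, rfl⟩
    · exact isClosed_empty_subset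
    · exact isClosed_Ici_subset (by positivity)
  refine ⟨h2.union h3.1, Set.union_subset ?_ h3.2⟩
  rintro _ ⟨k, rfl⟩
  change (0 : ℝ) ≤ 4 * k + c
  positivity

/-- The contacts at `4 k + c` recur after 4, and an edge that has become permanent is exempt from
recurring. The bound 4 is the same for all `U`, so knowing it does not reveal `U`. -/
theorem boundedRecurrent_of_fourStarts {G : TVG} (hconn : G.footprint.Connected) {U : Set ℝ}
    (hU : U = ∅ ∨ ∃ K : ℕ, U = Set.Ici (4 * (K : ℝ)))
    (h : ∀ u v, G.IsEdge u v → ∃ c, 0 ≤ c ∧ c ≤ 2 ∧ G.pres u v = span (fourStarts c U)) :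
    G.BoundedRecurrent 4 := by
  have hmem : ∀ (c : ℝ) (k : ℕ), 4 * (k : ℝ) + c ∈ span (fourStarts c U) := fun c k =>
    subset_span (Or.inl ⟨k, rfl⟩)
  refine ⟨⟨hconn, fun u v he t _ _ => ?_⟩, by norm_num, fun u v he => ?_⟩
  · obtain ⟨c, hc0, hc2, hp⟩ := h u v he
    obtain ⟨k, hk⟩ := exists_nat_gt t
    refine ⟨4 * k + c, ?_, hp ▸ hmem c k⟩
    have : (0 : ℝ) ≤ k := Nat.cast_nonneg k
    linarith
  · obtain ⟨c, hc0, hc2, hp⟩ := h u v he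
    constructor
    · have h0 := hmem c 0
      rw [← hp] at h0
      obtain ⟨s, -, h2, h3⟩ := TVG.exists_appearsAt TVG.neg_one_notMem h0
        (by simp only [Nat.cast_zero, mul_zero, zero_add]; linarith)
      exact ⟨s, by simp only [Nat.cast_zero, mul_zero, zero_add] at h2; linarith, h3⟩
    · rintro s hs ⟨r, hsr, hr⟩
      have hrU : ∀ K : ℕ, U = Set.Ici (4 * (K : ℝ)) → r < 4 * K := by
        rintro K rfl
        by_contra! hle
        exact hr (hp ▸ subset_span (Or.inr hle))
      have h1 := hs.1
      rw [hp] at h1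
      obtain ⟨a, ha, has, hsa⟩ := h1
      rcases ha with ⟨k, rfl⟩ | ha
      · dsimp only at has hsa
        -- Half a unit after the contact ends. The set `U` has not begun: the absence at `r > 4 k`
        -- gives `K ≥ k + 1`, whereas `c ≤ 2` keeps this date below `4 (k + 1)`.
        have habs : 4 * (k : ℝ) + c + 3 / 2 ∉ G.pres u v := by
          rw [hp]
          rintro ⟨a, ⟨j, rfl⟩ | ha, h2, h3⟩
          · dsimp only at h2 h3
            have h4 : (j : ℝ) < k + 1 := by linarith
            have h5 : (k : ℝ) < j := by linarith
            have h6 : j < k + 1 := by exact_mod_cast h4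
            have h7 : k < j := by exact_mod_cast h5
            omega
          · rcases hU with rfl | ⟨K, hK⟩
            · exact ha
            · have h4 := hrU K hK
              rw [hK] at ha
              have h5 : 4 * (K : ℝ) ≤ a := ha
              have h6 : (K : ℝ) < k + 1 := by linarith
              have h7 : (k : ℝ) < K := by linarith
              have h8 : K < k + 1 := by exact_mod_cast h6
              have h9 : k < K := by exact_mod_cast h7
              omega
        have h2 := hmem c (k + 1)
        rw [← hp] at h2
        push_cast at h2
        obtain ⟨s', h3, h4, h5⟩ := TVG.exists_appearsAt habs h2 (by linarith)
        exact ⟨s', by linarith, by linarith, h5⟩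
      · rcases hU with rfl | ⟨K, hK⟩
        · exact absurd ha (Set.notMem_empty a)
        · have h4 := hrU K hK
          rw [hK] at ha
          have h5 : 4 * (K : ℝ) ≤ a := ha
          linarith

/-- Contacts of node `1` with `0` and with `2`, at different dates except those in `U`. -/
def alternating (U : Set ℝ) (hU : U = ∅ ∨ ∃ K : ℕ, U = Set.Ici (4 * (K : ℝ))) : TVG :=
  tri (fourStarts 0 U) (fourStarts 2 U) ∅ (isClosed_fourStarts le_rfl hU)
    (isClosed_fourStarts zero_le_two hU) isClosed_empty_subset

section Alternating

variable {U : Set ℝ} {hU : U = ∅ ∨ ∃ K : ℕ, U = Set.Ici (4 * (K : ℝ))}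

theorem alternating_boundedRecurrent : (alternating U hU).BoundedRecurrent 4 := by
  have hne : ∀ c, (fourStarts c U).Nonempty := fun c => ⟨_, Or.inl ⟨0, rfl⟩⟩
  refine boundedRecurrent_of_fourStarts (tri_connected (hne 0) (hne 2)) hU fun u v => ?_
  refine triStarts_induction (p := fun S => (span S).Nonempty →
    ∃ c, 0 ≤ c ∧ c ≤ 2 ∧ span S = span (fourStarts c U)) ?_ ?_ ?_ ?_ u v
  · exact fun _ => ⟨0, le_rfl, zero_le_two, rfl⟩
  · exact fun _ => ⟨2, zero_le_two, le_rfl, rfl⟩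
  · rintro ⟨t, s, hs, -⟩
    exact absurd hs (Set.notMem_empty s)
  · rintro ⟨t, s, hs, -⟩
    exact absurd hs (Set.notMem_empty s)

theorem alternating_pres_one_zero : (alternating U hU).pres 1 0 = span (fourStarts 0 U) := by
  simp [alternating, tri, triStarts]

theorem alternating_pres_one_two : (alternating U hU).pres 1 2 = span (fourStarts 2 U) := by
  simp [alternating, tri, triStarts]

theorem eq_one_of_alternating_pres {u v : ℕ} {t : ℝ} (h : t ∈ (alternating U hU).pres u v)
    (hv : v = 0 ∨ v = 2) : u = 1 := by
  obtain ⟨s, hs, -⟩ := h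
  by_contra hu
  unfold triStarts at hs
  split_ifs at hs <;> first | omega | exact hs

theorem span_fourStarts_disjoint {t : ℝ} (h0 : t ∈ span (fourStarts 0 U))
    (h2 : t ∈ span (fourStarts 2 U)) (ht : ∀ s ∈ U, t < s) : False := by
  obtain ⟨a, ⟨k, rfl⟩ | ha, h3, h4⟩ := h0
  · obtain ⟨b, ⟨j, rfl⟩ | hb, h5, h6⟩ := h2
    · dsimp only at h3 h4 h5 h6
      have h7 : (j : ℝ) < k := by linarith
      have h8 : (k : ℝ) < j + 1 := by linarith
      have h9 : j < k := by exact_mod_cast h7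
      have h10 : k < j + 1 := by exact_mod_cast h8
      omega
    · linarith [ht b hb]
  · linarith [ht a ha]

theorem alternating_pres_iff {T : ℝ} (hT : ∀ s ∈ U, T < s) (u v : ℕ) (s : ℝ) (hs : s ≤ T) :
    s ∈ (alternating ∅ (Or.inl rfl)).pres u v ↔ s ∈ (alternating U hU).pres u v := by
  have key : ∀ c, s ∈ span (fourStarts c ∅) ↔ s ∈ span (fourStarts c U) := by
    intro c
    constructor
    · rintro ⟨a, ha | ha, h⟩
      · exact ⟨a, Or.inl ha, h⟩
      · exact absurd ha (Set.notMem_empty a)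
    · rintro ⟨a, ha | ha, h⟩
      · exact ⟨a, Or.inl ha, h⟩
      · linarith [hT a ha, h.1]
  simp only [alternating, tri, triStarts]
  split_ifs
  · exact key 0
  · exact key 2
  · rfl
  · rfl

end Alternating

/-- The emitter 1 meets 0 and 2 alternately and has emitted by `T`. Make both edges permanent from
`4 K > T` on: the minimum duration becomes `ζ = 1`. But the dissemination has begun by `T`, and
lasting at most `ζ` it would need both edges present at its initial date `a ≤ T`, when the contacts
are disjoint. -/
theorem TDBfastest_notMem_solvable : TDBfastest ∉ Solvable contextBΔ := by
  rintro ⟨A, hA⟩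
  obtain ⟨sent, t', hrun, -, -, ⟨T, hT⟩, -⟩ := exists_TDB_run hA (k := (4 : ℝ))
    (G := alternating ∅ (Or.inl rfl)) alternating_boundedRecurrent (x := 1)
    (by simp [alternating, tri])
  obtain ⟨J, hJ, hJT⟩ := hT 0 (by simp [alternating, tri])
  obtain ⟨K, hK⟩ := exists_nat_gt T
  have hTK : T < 4 * (K : ℝ) := by
    have : (0 : ℝ) ≤ K := Nat.cast_nonneg K
    linarith
  have hU : Set.Ici (4 * (K : ℝ)) = ∅ ∨ ∃ L : ℕ, Set.Ici (4 * (K : ℝ)) = Set.Ici (4 * (L : ℝ)) :=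
    Or.inr ⟨K, rfl⟩
  set G := alternating (Set.Ici (4 * (K : ℝ))) hU with hGdef
  have hζ : G.ζ = 1 := rfl
  obtain ⟨sent', t'', hrun', -, hsil, -, a, b, h1, h2, h3, h4⟩ := exists_TDB_run hA (k := (4 : ℝ))
    (G := G) alternating_boundedRecurrent (x := 1) (by simp [hGdef, alternating, tri])
  have hJ' := InfoJourney.of_agree (G' := G)
    (alternating_pres_iff fun s hs => lt_of_lt_of_le hTK hs) rfl hrun hrun' hJ hJT
  obtain ⟨s₀, w, hs₀, hinf⟩ : ∃ s₀ w, s₀ ≤ T ∧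
      (behaviour A G (4 : ℝ) (fun v => decide (v = 1)) 0 sent').info 1 w s₀ := by
    cases J with
    | nil => exact absurd hJ' (by simp [InfoJourney, IsJourney])
    | cons h J =>
      have h5 := IsJourney.date_add_le_arrival G.ζ_pos hJ' h (by simp)
      obtain ⟨h6, -, ⟨h7, -⟩, -⟩ := hJ'
      rw [h6] at h7
      refine ⟨h.date, h.dst, ?_, h7⟩
      have h8 : arrival G.ζ t' (h :: J) ≤ T := hJT
      linarith [G.ζ_pos]
  have hcross : ∀ c, Set.Icc (4 * (K : ℝ)) (4 * K + 1) ⊆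
      span (fourStarts c (Set.Ici (4 * (K : ℝ)))) := fun c =>
    icc_subset_span (Or.inr Set.self_mem_Ici)
  have hfast : FastestWindow G 1 t'' (4 * K) (4 * K + 1) := by
    refine ⟨?_, fun v hv => ?_, fun a' b' h5 h6 => ?_⟩
    -- The emission at `s₀ ≤ T` shows `t'' ≤ T < 4 K`, so the late window is a legitimate
    -- competitor.
    · linarith [hsil _ _ _ hinf]
    · have hv' : v < 3 := Finset.mem_range.1 hv
      interval_cases v
      · refine ⟨[⟨1, 0, 4 * K⟩], ⟨rfl, le_rfl, ?_, rfl⟩, by simp [arrival, hζ]⟩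
        unfold TVG.Crossable
        rw [hζ, alternating_pres_one_zero]
        exact hcross 0
      · exact ⟨[], rfl, by simp [arrival]⟩
      · refine ⟨[⟨1, 2, 4 * K⟩], ⟨rfl, le_rfl, ?_, rfl⟩, by simp [arrival, hζ]⟩
        unfold TVG.Crossable
        rw [hζ, alternating_pres_one_two]
        exact hcross 2
    · obtain ⟨J, h7, h8⟩ := h6 0 (by simp [hGdef, alternating, tri])
      obtain ⟨J', h, rfl, h9, h10, -⟩ := IsJourney.exists_last h7 one_ne_zero
      rw [arrival_append_singleton] at h8
      have := h9.le_arrival G.ζ_pos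
      linarith
  have hab := h4 _ _ hfast
  have haT : a ≤ T := (h2 _ _ hinf).trans hs₀
  -- A duration of at most `ζ` forces the last hop to depart exactly at `a`, and only node 1 is
  -- adjacent to 0 or 2.
  have hhop : ∀ v, v = 0 ∨ v = 2 → a ∈ G.pres 1 v := by
    intro v hv
    obtain ⟨J, h5, h6⟩ := h3 v (by rcases hv with rfl | rfl <;> simp [hGdef, alternating, tri])
    obtain ⟨J', h, rfl, h9, h10, ⟨-, hc⟩, rfl⟩ := IsJourney.exists_last h5 (by omega)
    rw [arrival_append_singleton] at h6
    have h11 := h9.le_arrival G.ζ_pos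
    have h12 : h.date = a := by linarith
    have h13 : h.date ∈ G.pres h.src h.dst := hc ⟨le_rfl, by linarith [G.ζ_pos]⟩
    have h14 := eq_one_of_alternating_pres h13 hv
    rwa [h14, h12] at h13
  have h5 := hhop 0 (Or.inl rfl)
  have h6 := hhop 2 (Or.inr rfl)
  rw [alternating_pres_one_zero] at h5
  rw [alternating_pres_one_two] at h6
  exact span_fourStarts_disjoint h5 h6 fun s hs => lt_of_le_of_lt haT (lt_of_lt_of_le hTK hs)

end DynNet

theorem mainTheorem1 :
    DynNet.Solvable DynNet.contextRn ⊂ DynNet.Solvable DynNet.contextBΔ ∧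
    DynNet.Solvable DynNet.contextBΔ ⊂ DynNet.Solvable DynNet.contextPp ∧
    (DynNet.TDBshortest ∈ DynNet.SolvableAtOnce DynNet.contextBΔ ∧
      DynNet.TDBshortest ∈ DynNet.Solvable DynNet.contextBΔ ∧
      DynNet.TDBshortest ∉ DynNet.Solvable DynNet.contextRn) ∧
    (DynNet.TDBfastest ∈ DynNet.SolvableAtOnce DynNet.contextPp ∧
      DynNet.TDBfastest ∈ DynNet.Solvable DynNet.contextPp ∧
      DynNet.TDBfastest ∉ DynNet.Solvable DynNet.contextBΔ) := by
  have h1 := DynNet.TDBshortest_mem_solvableAtOnce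
  have h2 := DynNet.TDBfastest_mem_solvableAtOnce
  have h3 := DynNet.solvableAtOnce_subset _ h1
  have h4 := DynNet.solvableAtOnce_subset _ h2
  have h5 := DynNet.TDBshortest_notMem_solvable
  have h6 := DynNet.TDBfastest_notMem_solvable
  exact ⟨⟨DynNet.solvable_contextRn_subset, fun h => h5 (h h3)⟩,
    ⟨DynNet.solvable_contextBΔ_subset, fun h => h6 (h h4)⟩, ⟨h1, h3, h5⟩, h2, h4, h6⟩
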